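/- **Symbols and regularisations.** Let $\mathcal A$ be the $\mathbb C$-algebra of functions on $[1,\infty)$ generated by the functions $\sigma_s^v(\xi)=(\xi+v)^{-s}$, $s\in\mathbb C$, $v\ge 0$ (equivalently, classes of positively supported symbols on $\mathbb R$ modulo functions vanishing on $[1,\infty)$); put $\sigma_s=\sigma_s^0$. A *simple holomorphic family* of order $\alpha$ on an open set $W\subset\mathbb C$ is a holomorphic family $(f(z))_{z\in W}$ in $C^\infty(\mathbb R)$, with $f(z)$ supported in $]0,\infty[$, such that $f(z)(\xi)\sim\sum_{j\ge 0}a_j(z)\,\xi^{\alpha(z)-j}$ as $\xi\to+\infty$, where $\alpha$ and the $a_j$ are holomorphic on $W$, with the classical symbol estimates for the remainders and all their $\xi$-derivatives, locally uniformly in $z\in W$. A *holomorphic regularisation* $\mathcal R$ on $\mathcal A$ is a linear map $f\mapsto (f(z))_{z\in W}$, with $W$ an open neighbourhood of $0$, such that $f(0)=f$ and, on $[1,\infty)$, $f(z)$ is a finite sum of simple holomorphic families on $W$ whose orders satisfy $\operatorname{Re}\alpha_i'(z)<0$ for all $z\in W$. **Renormalised nested sums.** For functions $g_1,\dots,g_k$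 on $[1,\infty)$ let $\mathrm S_{<}(g_1\otimes\cdots\otimes g_k)$, extended linearly to tensors, denote the finite part (constant term of the asymptotic expansion in the functions $N^a\log^l N$) as $N\to\infty$ of $\sum_{0<n_k<\cdots<n_1\le N}g_1(n_1)\cdots g_k(n_k)$. For a composition $I=(i_1,\dots,i_r)$ of $k$, let $I[u]$ be obtained from $u=f_1\otimes\cdots\otimes f_k$ by multiplying together the letters in each of the successive blocks of lengths $i_1,\dots,i_r$, and set $$\exp u=\sum_I\frac{1}{i_1!\cdots i_r!}I[u],\qquad \log u=\sum_I\frac{(-1)^{k-r}}{i_1\cdots i_r}I[u].$$ With $\widetilde{\mathcal R}(f_1\otimes\cdots\otimes f_k)(z)=f_1(z)\otimes\cdots\otimes f_k(z)$, put $\Psi^{\mathcal R}(u)(z)=\mathrm S_{<}\big((\exp\circ\widetilde{\mathcal R}\circ\log)(u)(z)\big)$, viewed as a meromorphic germ at $z=0$. Let $\pi$ be the projection of such germs onto their pole part in $z^{-1}\mathbb C[z^{-1}]$, and define recursively $\Psi_\pm^{\mathcal R}(1)=1$ and, for $u=f_1\otimes\cdots\otimes f_k$ with $k\ge1$, $$\overline\Psi(u)=\Psi^{\mathcal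 R}(u)+\sum_{j=1}^{k-1}\Psi^{\mathcal R}_-(f_1\otimes\cdots\otimes f_j)\,\Psi^{\mathcal R}(f_{j+1}\otimes\cdots\otimes f_k),\quad \Psi_-^{\mathcal R}(u)=-\pi\,\overline\Psi(u),\quad \Psi_+^{\mathcal R}(u)=(1-\pi)\,\overline\Psi(u).$$ The renormalised nested sum is $\psi^{\mathcal R}(u)=\Psi_+^{\mathcal R}(u)(0)$, and the renormalised multiple zeta values are $$\zeta^{\mathcal R}(s_1,\dots,s_k)=\psi^{\mathcal R}(\sigma_{s_1}\otimes\cdots\otimes\sigma_{s_k}).$$ **Higher dimension.** Let $n\ge 1$, let $|\cdot|$ be the supremum norm on $\mathbb R^n$, and let $A_n(t)=(2t+1)^n-(2t-1)^n$, which for a positive integer $t$ is the number of points of $\mathbb Z^n$ of norm $t$. Let $M(f)=(f/A_n)\circ|\cdot|$, an injective linear map from $\mathcal A$ to the radial functions on $\{x\in\mathbb R^n:|x|\ge1\}$. The higher-dimensional renormalised nested sum of $\tau_1\otimes\cdots\otimes\tau_k$, with $\tau_i\in M(\mathcal A)$, is $\psi^{\mathcal R}(M^{-1}\tau_1\otimes\cdots\otimes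 M^{-1}\tau_k)$, and $\zeta_n^{\mathcal R}(s_1,\dots,s_k)$ is by definition its value at $\tau_i=|\cdot|^{-s_i}$. **Theorem.** For every holomorphic regularisation $\mathcal R$ on $\mathcal A$, all integers $n\ge1$ and $k\ge0$, and all $s_1,\dots,s_k\in\mathbb C$, $$\zeta_n^{\mathcal R}(s_1,\dots,s_k)=\sum_{J=(j_1,\dots,j_k),\ 0\le j_r\le\lfloor n/2\rfloor}2^{\,nk-2|J|}\binom n{2j_1+1}\cdots\binom n{2j_k+1}\,\zeta^{\mathcal R}(s_1-n+2j_1+1,\dots,s_k-n+2j_k+1),$$ where $|J|=j_1+\cdots+j_k$. In particular $\zeta_n^{\mathcal R}(s_1,\dots,s_k)$ is an explicit integer combination of one-dimensional renormalised multiple zeta values. -/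

import Mathlib

open Filter Topology
open scoped NNReal ContDiff Polynomial

noncomputable section

namespace RenormZeta

/-! ### Symbols and holomorphic regularisations -/

/-- The half line `[1, ∞)`.  Functions on it represent classes of positively supported functions
on `ℝ` modulo the functions which vanish on `[1, ∞)`. -/
abbrev Ray : Type := Set.Ici (1 : ℝ)

/-- The positive integer `m + 1` as a point of `[1, ∞)`. -/
def Ray.ofSucc (m : ℕ) : Ray :=
  ⟨(m : ℝ) + 1, by
    simp⟩

/-- The function `ξ ↦ (ξ + v)^(-s)` on `[1, ∞)`. -/
def hurwitzFun (s : ℂ) (v : ℝ≥0) : Ray → ℂ := fun ξ => (((ξ : ℝ) + (v : ℝ) : ℝ) : ℂ) ^ (-s)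

/-- The algebra `𝒜` generated by the classes `σ_s^v` of positively supported symbols that are equal
to `(ξ + v)^(-s)` for `ξ ≥ 1`, with `s ∈ ℂ` and `v ≥ 0`. -/
def zetaAlg : Subalgebra ℂ (Ray → ℂ) :=
  Algebra.adjoin ℂ (Set.range fun p : ℂ × ℝ≥0 => hurwitzFun p.1 p.2)

/-- The element `σ_s^v` of `𝒜`. -/
def sigma (s : ℂ) (v : ℝ≥0) : zetaAlg :=
  ⟨hurwitzFun s v, Algebra.subset_adjoin ⟨(s, v), rfl⟩⟩

/-- `F` is a simple holomorphic family, parametrised by `W`, of positively supported classical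
symbols on `ℝ`, with holomorphic order `α`: each `F z` is smooth with support in `]0, ∞[`, the map
`z ↦ F z` is holomorphic for the topology of `C^∞(ℝ)`, and
`F z ξ ∼ ∑_j a_j(z) ξ^(α(z) - j)` as `ξ → +∞`, with `a_j` holomorphic and with the usual
symbol estimates for the remainders, locally uniformly in `z`.  (The corresponding estimates for
the `z`-derivatives of the remainders follow from Cauchy's inequalities.) -/
structure IsSimpleHolFamily (W : Set ℂ) (α : ℂ → ℂ) (F : ℂ → ℝ → ℂ) : Prop where
  smooth : ∀ z ∈ W, ContDiff ℝ ∞ (F z)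
  support : ∀ z ∈ W, Function.support (F z) ⊆ Set.Ioi 0
  holo : ∀ (m : ℕ) (ξ : ℝ), DifferentiableOn ℂ (fun z => iteratedDeriv m (F z) ξ) W
  cont : ∀ m : ℕ, ContinuousOn (fun p : ℂ × ℝ => iteratedDeriv m (F p.1) p.2) (W ×ˢ Set.univ)
  order_holo : DifferentiableOn ℂ α W
  expansion : ∃ a : ℕ → ℂ → ℂ, (∀ j, DifferentiableOn ℂ (a j) W) ∧
    ∀ (J m : ℕ) (K : Set ℂ), K ⊆ W → IsCompact K → ∃ C : ℝ, ∀ z ∈ K, ∀ ξ : ℝ, 1 ≤ ξ →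
      ‖iteratedDeriv m
          (fun t : ℝ => F z t - ∑ j ∈ Finset.range J, a j z * (t : ℂ) ^ (α z - (j : ℂ))) ξ‖
        ≤ C * ξ ^ ((α z).re - J - m)

/-- `R` is a (linear) holomorphic regularisation procedure on `𝒜`, parametrised by the open
neighbourhood `W` of `0`: `R f` is (the class on `[1, ∞)` of) a finite sum of simple holomorphic
families of positively supported classical symbols, whose orders `α_i` satisfy `Re α_i' < 0` on
`W`, and `R f 0 = f`. -/
structure IsHolRegularisation (W : Set ℂ) (R : zetaAlg →ₗ[ℂ] ℂ → Ray → ℂ) : Prop where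
  isOpen : IsOpen W
  zero_mem : (0 : ℂ) ∈ W
  at_zero : ∀ f : zetaAlg, R f 0 = (f : Ray → ℂ)
  family : ∀ f : zetaAlg, ∃ (m : ℕ) (α : Fin m → ℂ → ℂ) (F : Fin m → ℂ → ℝ → ℂ),
    (∀ i, IsSimpleHolFamily W (α i) (F i)) ∧
    (∀ i, ∀ z ∈ W, (deriv (α i) z).re < 0) ∧
    ∀ z ∈ W, ∀ ξ : Ray, R f z ξ = ∑ i, F i z ξ

/-! ### Cut-off nested sums

A word `[f₁, …, f_k]` stands for the tensor `f₁ ⊗ ⋯ ⊗ f_k`. -/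

/-- The truncated nested sum `∑_{0 < n_k < ⋯ < n_1 ≤ N} f₁(n_1) ⋯ f_k(n_k)`. -/
def nestedSum : List (Ray → ℂ) → ℕ → ℂ
  | [], _ => 1
  | f :: w, N => ∑ m ∈ Finset.range N, f (Ray.ofSucc m) * nestedSum w m

/-- `u N` has, up to a term tending to `0`, an asymptotic expansion in the functions
`N^a (log N)^l` as `N → ∞`, in which `c` is the constant term. -/
def HasFinitePart (u : ℕ → ℂ) (c : ℂ) : Prop :=
  ∃ (S : Finset (ℂ × ℕ)) (b : ℂ × ℕ → ℂ), (0, 0) ∉ S ∧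
    Tendsto (fun N : ℕ =>
      u N - (c + ∑ p ∈ S, b p * ((N : ℂ) ^ p.1 * ((Real.log N : ℝ) : ℂ) ^ p.2))) atTop (𝓝 0)

open Classical in
/-- The finite part of `u N` as `N → ∞`. -/
def finitePart (u : ℕ → ℂ) : ℂ :=
  if h : ∃ c, HasFinitePart u c then h.choose else 0

/-- The cut-off nested sum (strict inequalities) of a word. -/
def cutoffNestedSum (w : List (Ray → ℂ)) : ℂ := finitePart (nestedSum w)

/-! ### Hoffman's isomorphism and the regularisation of tensors -/

/-- `I[u]`: multiply together the letters of `u` inside each block of the composition `I`. -/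
def contract {B : Type*} [Monoid B] (u : List B) (I : Composition u.length) : List B :=
  (u.splitWrtComposition I).map List.prod

/-- The value at the word `u` of `φ ∘ exp`, where `exp` is Hoffman's map
`exp u = ∑_I (1 / (i₁! ⋯ i_r!)) I[u]` and `φ` is extended linearly. -/
def compExp {B : Type*} [Monoid B] (φ : List B → ℂ) (u : List B) : ℂ :=
  ∑ I : Composition u.length, 1 / (((I.blocks.map Nat.factorial).prod : ℕ) : ℂ) * φ (contract u I)

/-- The value at the word `u` of `φ ∘ log`, where `log` is the inverse
`log u = ∑_I ((-1)^(|u| - r) / (i₁ ⋯ i_r)) I[u]` of Hoffman's map. -/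
def compLog {B : Type*} [Monoid B] (φ : List B → ℂ) (u : List B) : ℂ :=
  ∑ I : Composition u.length,
    (-1) ^ (u.length - I.length) / ((I.blocks.prod : ℕ) : ℂ) * φ (contract u I)

/-- `Ψ^R(w)(z)`: the cut-off nested sum of `(exp ∘ R̃ ∘ log)(w)(z)`, where
`R̃(f₁ ⊗ ⋯ ⊗ f_k)(z) = f₁(z) ⊗ ⋯ ⊗ f_k(z)`. -/
def regSum (R : zetaAlg →ₗ[ℂ] ℂ → Ray → ℂ) (w : List zetaAlg) (z : ℂ) : ℂ :=
  compLog (fun u : List zetaAlg => compExp cutoffNestedSum (u.map fun f => R f z)) w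

/-! ### Birkhoff factorisation with minimal subtraction

Meromorphic germs at `0` are represented by functions, only the values on a punctured neighbourhood
of `0` being relevant. -/

/-- `q(1/z)` is the pole part at `0` of `g`. -/
def IsPolePart (g : ℂ → ℂ) (q : ℂ[X]) : Prop :=
  q.coeff 0 = 0 ∧
    ∃ h : ℂ → ℂ, AnalyticAt ℂ h 0 ∧ ∀ᶠ z in 𝓝[≠] (0 : ℂ), g z = q.eval z⁻¹ + h z

open Classical in
/-- The projection `π` onto the pole part, an element of `z⁻¹ ℂ[z⁻¹]`. -/
def polePart (g : ℂ → ℂ) : ℂ → ℂ :=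
  if h : ∃ q, IsPolePart g q then fun z => h.choose.eval z⁻¹ else 0

/-- `Φ_-`, for the deconcatenation coproduct: `Φ_-(1) = 1` and
`Φ_-(w) = -π(Φ(w) + ∑ Φ_-(w') Φ(w''))`, the sum being over `w = w' w''` with `w', w''` nonempty. -/
def birkhoffMinus {B : Type*} (Φ : List B → ℂ → ℂ) (w : List B) : ℂ → ℂ :=
  if w = [] then 1 else
    -polePart (Φ w + ∑ j : Fin (w.length - 1),
      birkhoffMinus Φ (w.take (j + 1)) * Φ (w.drop (j + 1)))
termination_by w.length
decreasing_by
  have := j.2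
  simp only [List.length_take]
  omega

/-- `Φ_+`: `Φ_+(1) = 1` and `Φ_+(w) = (1 - π)(Φ(w) + ∑ Φ_-(w') Φ(w''))`. -/
def birkhoffPlus {B : Type*} (Φ : List B → ℂ → ℂ) (w : List B) : ℂ → ℂ :=
  if w = [] then 1 else
    let g := Φ w + ∑ j : Fin (w.length - 1),
      birkhoffMinus Φ (w.take (j + 1)) * Φ (w.drop (j + 1))
    g - polePart g

/-- The renormalised nested sum `ψ^R(w) = Ψ^R_+(w)(0)`, the value at `0` of the germ, holomorphic
at `0`, of `Ψ^R_+(w)`. -/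
def renormSum (R : zetaAlg →ₗ[ℂ] ℂ → Ray → ℂ) (w : List zetaAlg) : ℂ :=
  limUnder (𝓝[≠] (0 : ℂ)) (birkhoffPlus (regSum R) w)

/-- Renormalised multiple Hurwitz zeta values `ζ^R(s_1, …, s_k; v_1, …, v_k)`. -/
def zetaHurwitzR (R : zetaAlg →ₗ[ℂ] ℂ → Ray → ℂ) {k : ℕ} (s : Fin k → ℂ) (v : Fin k → ℝ≥0) : ℂ :=
  renormSum R (List.ofFn fun r => sigma (s r) (v r))

/-- Renormalised multiple zeta values `ζ^R(s_1, …, s_k)`. -/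
def zetaR (R : zetaAlg →ₗ[ℂ] ℂ → Ray → ℂ) {k : ℕ} (s : Fin k → ℂ) : ℂ :=
  zetaHurwitzR R s 0

/-! ### Radial symbols on `ℝ^n` for the supremum norm -/

/-- `A_n(t) = (2t+1)^n - (2t-1)^n`. -/
def shell (n : ℕ) (t : ℝ) : ℝ := (2 * t + 1) ^ n - (2 * t - 1) ^ n

/-- For a positive integer `t`, `A_n(t)` is the number of points of `ℤ^n` of supremum norm `t`. -/
theorem shell_eq_card (n t : ℕ) (ht : 1 ≤ t) :
    shell n t = ({x : Fin n → ℤ | ‖x‖ = t} : Set (Fin n → ℤ)).ncard := by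
  obtain ⟨u, rfl⟩ : ∃ u, t = u + 1 := ⟨t - 1, by omega⟩
  let box : ℕ → Finset (Fin n → ℤ) := fun m => Fintype.piFinset fun _ => Finset.Icc (-(m : ℤ)) m
  have hmem : ∀ (m : ℕ) (x : Fin n → ℤ), x ∈ box m ↔ ‖x‖ ≤ m := by
    intro m x
    rw [pi_norm_le_iff_of_nonneg (Nat.cast_nonneg m)]
    simp only [box, Fintype.mem_piFinset, Finset.mem_Icc, Int.norm_eq_abs]
    refine forall_congr' fun i => ?_
    rw [← abs_le]
    exact_mod_cast Iff.rfl
  have hnat : ∀ x : Fin n → ℤ, ∃ m : ℕ, ‖x‖ = m := by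
    intro x
    refine ⟨Finset.univ.sup fun i => (x i).natAbs, le_antisymm ?_ ?_⟩
    · refine (pi_norm_le_iff_of_nonneg (Nat.cast_nonneg _)).2 fun i => ?_
      rw [Int.norm_eq_abs, ← Int.cast_abs, Int.abs_eq_natAbs, Int.cast_natCast]
      exact_mod_cast Finset.le_sup (f := fun i => (x i).natAbs) (Finset.mem_univ i)
    · have h : (Finset.univ.sup fun i => (x i).natAbs) ≤ ⌊‖x‖⌋₊ := by
        refine Finset.sup_le fun i _ => Nat.le_floor ?_
        have h1 := norm_le_pi_norm x i
        rwa [Int.norm_eq_abs, ← Int.cast_abs, Int.abs_eq_natAbs, Int.cast_natCast] at h1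
      exact (Nat.cast_le.2 h).trans (Nat.floor_le (norm_nonneg x))
  have hset : ({x : Fin n → ℤ | ‖x‖ = (u + 1 : ℕ)} : Set (Fin n → ℤ)) =
      ((box (u + 1) \ box u : Finset (Fin n → ℤ)) : Set (Fin n → ℤ)) := by
    ext x
    obtain ⟨m, hm⟩ := hnat x
    simp only [Set.mem_ofPred_eq, Finset.coe_sdiff, Set.mem_sdiff, Finset.mem_coe, hmem, hm,
      Nat.cast_le, Nat.cast_inj]
    omega
  have hsub : box u ⊆ box (u + 1) := by
    intro x hx
    rw [hmem] at hx ⊢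
    push_cast
    linarith
  have hcard : ∀ m : ℕ, (((box m).card : ℕ) : ℝ) = (2 * (m : ℝ) + 1) ^ n := by
    intro m
    have h : (box m).card = (2 * m + 1) ^ n := by
      simp only [box, Fintype.card_piFinset, Int.card_Icc, Finset.prod_const, Finset.card_univ,
        Fintype.card_fin]
      congr 1
      omega
    rw [h]
    push_cast
    ring
  rw [hset, Set.ncard_coe_finset, Finset.card_sdiff_of_subset hsub,
    Nat.cast_sub (Finset.card_le_card hsub), hcard, hcard, shell]
  push_cast
  ring

/-- The set of points of `ℝ^n` of supremum norm at least `1` (the norm of `Fin n → ℝ` is the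
supremum norm); it contains all nonzero points of `ℤ^n`. -/
abbrev OuterSpace (n : ℕ) : Type := {x : Fin n → ℝ // 1 ≤ ‖x‖}

/-- The isomorphism `f ↦ f ∘ |·|` of `𝒜` onto the algebra of radial symbols. -/
def radial (n : ℕ) (f : zetaAlg) : OuterSpace n → ℂ :=
  fun x => (f : Ray → ℂ) ⟨‖x.1‖, x.2⟩

/-- The operator `M(f) = (f / A_n) ∘ |·|` from `𝒜` to radial functions. It is injective if `n ≥ 1`,
and an isomorphism of `𝒜` onto its image `𝒜_n`. -/
def radialM (n : ℕ) (f : zetaAlg) : OuterSpace n → ℂ :=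
  fun x => (f : Ray → ℂ) ⟨‖x.1‖, x.2⟩ / (shell n ‖x.1‖ : ℂ)

/-- The higher-dimensional renormalised nested sum of a word of radial symbols: the renormalised
nested sum of its inverse image by `M` applied to each letter. -/
def renormSumRadial (R : zetaAlg →ₗ[ℂ] ℂ → Ray → ℂ) (n : ℕ) (w : List (OuterSpace n → ℂ)) : ℂ :=
  renormSum R (w.map (Function.invFun (radialM n)))

/-- Higher-dimensional renormalised multiple Hurwitz zeta values: the renormalised nested sum of
the radial symbols `x ↦ (|x| + v_r)^(-s_r)` on `ℝ^n`. -/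
def zetaHurwitzRn (R : zetaAlg →ₗ[ℂ] ℂ → Ray → ℂ) (n : ℕ) {k : ℕ} (s : Fin k → ℂ)
    (v : Fin k → ℝ≥0) : ℂ :=
  renormSumRadial R n (List.ofFn fun r => radial n (sigma (s r) (v r)))

/-- Higher-dimensional renormalised multiple zeta values `ζ_n^R(s_1, …, s_k)`. -/
def zetaRn (R : zetaAlg →ₗ[ℂ] ℂ → Ray → ℂ) (n : ℕ) {k : ℕ} (s : Fin k → ℂ) : ℂ :=
  zetaHurwitzRn R n s 0

end RenormZeta

end

open RenormZeta

namespace RenormZeta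

/-! ### Uniqueness and linearity of finite parts -/

/-! The binomial theorem gives `A_n(t) = ∑_j 2^(n-2j) (n choose 2j+1) t^(n-2j-1)`, so the inverse
image under `M` of `|·|^(-s)` is `A_n σ_s = ∑_j 2^(n-2j) (n choose 2j+1) σ_(s-n+2j+1)`
(`radialM_injective`, `radialM_sum_sigma`). The formula is then the expansion of `ψ^R` as a
multilinear function of its letters.

The substance is therefore the multilinearity of `ψ^R`. It is not formal: `finitePart` and
`polePart` are chosen values, with default `0`, so each is linear only where existence and
uniqueness are known.

Uniqueness of finite parts rests on the independence of the functions `N^a (log N)^l` up to `o(1)`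
(`polynomial_zero_eq_zero_of_tendsto`). Existence, with meromorphic dependence on `z`, comes from
the calculus `IsPhg` of expansions in powers `N^(a z)`. The hypothesis `Re a' < 0` survives
products, since exponents add, and it makes `a + 1` nonzero for `z ≠ 0` near `0`. Partial sums of
`m^a` can thus be obtained by dividing by `a + 1`: no logarithm appears, and the price is a pole at
`z = 0` (`IsPhg.sum_pow`). Summation creates one further exponent, the constant `0`; multiplying by
the next symbol makes the exponents decreasing again, so induction on the depth goes through.

Multilinearity with values in meromorphic germs then passes through the contractions in `exp` and
`log` (`IsGermMultilinear.sum_contract`), and, because pole parts are unique, through the Birkhoff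
recursion (`isGermLinear_birkhoffBar`). -/

/-- A polynomial in `log N` that tends to `0` is the zero polynomial. -/
theorem eq_zero_of_tendsto_eval_log {P : ℂ[X]}
    (h : Tendsto (fun N : ℕ => P.eval ((Real.log N : ℝ) : ℂ)) atTop (𝓝 0)) : P = 0 := by
  by_cases hd : 0 < P.degree
  · have h1 : Tendsto (fun N : ℕ => ‖((Real.log N : ℝ) : ℂ)‖) atTop atTop := by
      simp only [Complex.norm_real]
      exact tendsto_norm_atTop_atTop.comp (Real.tendsto_log_atTop.comp tendsto_natCast_atTop_atTop)
    exact absurd h.norm (not_tendsto_nhds_of_tendsto_atTop (P.tendsto_norm_atTop hd h1) _)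
  · rw [Polynomial.eq_C_of_degree_le_zero (not_lt.1 hd)] at h ⊢
    simp only [Polynomial.eval_C] at h
    rw [tendsto_nhds_unique tendsto_const_nhds h, Polynomial.C_0]

/-- If `2^a = 3^a = 1`, then `a log 2` and `a log 3` are both integer multiples of `2πi`, whence
`2^l = 3^k` with `k ≠ 0`, against parity. One base would not suffice: `q^a = 1` also for `a = 2πi /
log q`. -/
theorem natCast_cpow_two_or_three_ne_one {a : ℂ} (ha : a ≠ 0) :
    ∃ q : ℕ, 0 < q ∧ ((q : ℂ) ^ a ≠ 1) := by
  by_contra! hcon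
  have key : ∀ q : ℕ, 1 < q → ∃ k : ℤ, Real.log q * a = k * (2 * Real.pi * Complex.I) := by
    intro q hq
    have h := hcon q (by omega)
    rw [Complex.cpow_def_of_ne_zero (by exact_mod_cast (by omega : q ≠ 0)),
      Complex.exp_eq_one_iff] at h
    obtain ⟨k, hk⟩ := h
    exact ⟨k, by rw [← hk, Complex.natCast_log]⟩
  obtain ⟨k, hk⟩ := key 2 (by norm_num)
  obtain ⟨l, hl⟩ := key 3 (by norm_num)
  have hpi : (2 * Real.pi * Complex.I : ℂ) ≠ 0 := Complex.two_pi_I_ne_zero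
  have h2 : 0 < Real.log ((2 : ℕ) : ℝ) := Real.log_pos (by norm_num)
  have h3 : 0 < Real.log ((3 : ℕ) : ℝ) := Real.log_pos (by norm_num)
  have hk0 : k ≠ 0 := by
    rintro rfl
    simp only [Int.cast_zero, zero_mul, mul_eq_zero, Complex.ofReal_eq_zero] at hk
    exact hk.elim h2.ne' ha
  have e : (l : ℝ) * Real.log ((2 : ℕ) : ℝ) = k * Real.log ((3 : ℕ) : ℝ) := by
    have : (l : ℂ) * Real.log ((2 : ℕ) : ℝ) * a = k * Real.log ((3 : ℕ) : ℝ) * a := by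
      linear_combination (l : ℂ) * hk - (k : ℂ) * hl
    exact_mod_cast mul_right_cancel₀ ha this
  have e' : (l.natAbs : ℝ) * Real.log ((2 : ℕ) : ℝ) = k.natAbs * Real.log ((3 : ℕ) : ℝ) := by
    have := congrArg abs e
    rwa [abs_mul, abs_mul, abs_of_pos h2, abs_of_pos h3, ← Int.cast_abs, ← Int.cast_abs,
      Int.abs_eq_natAbs, Int.abs_eq_natAbs, Int.cast_natCast, Int.cast_natCast] at this
  rw [← Real.log_pow, ← Real.log_pow] at e'
  have e2 := Real.log_injOn_pos (Set.mem_Ioi.2 (by positivity)) (Set.mem_Ioi.2 (by positivity)) e'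
  have e3 : 2 ^ l.natAbs = 3 ^ k.natAbs := by exact_mod_cast e2
  have hodd : Odd (2 ^ l.natAbs) := e3 ▸ Odd.pow (by decide)
  have hl0 : l.natAbs = 0 := by
    by_contra h0
    exact Nat.not_even_iff_odd.2 hodd ((even_two).pow_of_ne_zero h0)
  rw [hl0, pow_zero] at e3
  have := Nat.one_lt_pow (Int.natAbs_ne_zero.2 hk0) (by norm_num : 1 < 3)
  omega

/-- In a sum of terms `N^a P_a(log N)` that tends to `0`, the polynomial `P_0` vanishes. -/
theorem polynomial_zero_eq_zero_of_tendsto (m : ℕ) :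
    ∀ (A : Finset ℂ) (d : ℂ → ℕ) (P : ℂ → ℂ[X]) (P₀ : ℂ[X]), 0 ∉ A → ∑ a ∈ A, d a = m →
      (∀ a ∈ A, (P a).degree < d a) →
      Tendsto (fun N : ℕ => P₀.eval ((Real.log N : ℝ) : ℂ) +
        ∑ a ∈ A, (N : ℂ) ^ a * (P a).eval ((Real.log N : ℝ) : ℂ)) atTop (𝓝 0) → P₀ = 0 := by
  classical
  induction m with
  | zero =>
    intro A d P P₀ _ hs hd ht
    refine eq_zero_of_tendsto_eval_log (ht.congr fun N => ?_)
    rw [Finset.sum_eq_zero, add_zero]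
    intro a ha
    have h0 : d a = 0 := Finset.sum_eq_zero_iff.1 hs a ha
    have := hd a ha
    rw [h0, Polynomial.degree_lt_iff_coeff_zero] at this
    have hP : P a = 0 := by
      ext i
      simpa using this i (Nat.zero_le i)
    simp [hP]
  | succ m ih =>
    intro A d P P₀ h0 hs hd ht
    obtain ⟨a, ha, hda⟩ : ∃ a ∈ A, d a ≠ 0 := by
      by_contra! h
      rw [Finset.sum_eq_zero h] at hs
      omega
    have ha0 : a ≠ 0 := fun h => h0 (h ▸ ha)
    obtain ⟨q, hq, hqa⟩ := natCast_cpow_two_or_three_ne_one ha0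
    set x : ℂ := ((Real.log q : ℝ) : ℂ) with hx
    have hq0 : ∀ b : ℂ, (q : ℂ) ^ b ≠ 0 := fun b => by
      rw [Complex.cpow_def_of_ne_zero (by exact_mod_cast hq.ne')]
      exact Complex.exp_ne_zero _
    -- These are the coefficients of `u(qN) - q^a u(N)`, where `u` is the given sum. The leading
    -- term of `P a` cancels, so its degree bound drops by one, and no other bound grows. The
    -- induction is on the sum of these bounds.
    let P' : ℂ → ℂ[X] := fun b =>
      Polynomial.C ((q : ℂ) ^ b) * Polynomial.taylor x (P b) - Polynomial.C ((q : ℂ) ^ a) * P b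
    let P₀' : ℂ[X] := Polynomial.taylor x P₀ - Polynomial.C ((q : ℂ) ^ a) * P₀
    have hP₀' : P₀' = 0 := by
      refine ih A (Function.update d a (d a - 1)) P' P₀' h0 ?_ ?_ ?_
      · rw [Finset.sum_update_of_mem ha]
        have hs' := Finset.add_sum_erase A d ha
        rw [Finset.sdiff_singleton_eq_erase]
        omega
      · intro b hb
        by_cases hba : b = a
        · subst hba
          rw [Function.update_self]
          by_cases hPb : P b = 0
          · simp only [P', hPb, map_zero, mul_zero, sub_zero, Polynomial.degree_zero]
            exact WithBot.bot_lt_coe _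
          · have h1 : (P' b).degree < (P b).degree := by
              have : P' b = Polynomial.C ((q : ℂ) ^ b) * (Polynomial.taylor x (P b) - P b) := by
                simp only [P']; ring
              rw [this, Polynomial.degree_C_mul (hq0 b)]
              refine (Polynomial.degree_sub_lt_left (Polynomial.degree_taylor _ _) ?_ ?_).trans_eq
                (Polynomial.degree_taylor _ _)
              · rwa [Ne, Polynomial.taylor_eq_zero]
              · rw [Polynomial.leadingCoeff_taylor]
            have h2 := hd b hb
            rw [Polynomial.degree_eq_natDegree hPb, Nat.cast_lt] at h2
            rw [Polynomial.degree_eq_natDegree hPb] at h1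
            exact h1.trans_le (by exact_mod_cast (by omega : (P b).natDegree ≤ d b - 1))
        · rw [Function.update_of_ne hba]
          refine (Polynomial.degree_sub_le _ _).trans_lt (max_lt ?_ ?_)
          · rw [Polynomial.degree_C_mul (hq0 b), Polynomial.degree_taylor]
            exact hd b hb
          · rw [Polynomial.degree_C_mul (hq0 a)]
            exact hd b hb
      · have ht1 := ht.comp (tendsto_id.const_mul_atTop' hq)
        have ht2 := ht1.sub (ht.const_mul ((q : ℂ) ^ a))
        rw [mul_zero, sub_zero] at ht2
        refine ht2.congr' ?_
        filter_upwards [eventually_ge_atTop 1] with N hN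
        have hlog : ((Real.log ((q : ℝ) * N) : ℝ) : ℂ) = ((Real.log N : ℝ) : ℂ) + x := by
          rw [Real.log_mul (by positivity) (by positivity), Complex.ofReal_add, add_comm]
        simp only [Function.comp_apply, id_eq, hlog, Nat.cast_mul, Complex.natCast_mul_natCast_cpow,
          P', P₀', Polynomial.eval_sub, Polynomial.eval_mul, Polynomial.eval_C,
          Polynomial.taylor_eval, mul_add, mul_sub, Finset.sum_sub_distrib, Finset.mul_sum]
        have e1 : ∀ b : ℂ, (N : ℂ) ^ b * ((q : ℂ) ^ b * (P b).eval (((Real.log N : ℝ) : ℂ) + x)) =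
          (q : ℂ) ^ b * (N : ℂ) ^ b * (P b).eval (((Real.log N : ℝ) : ℂ) + x) := fun b => by ring
        have e2 : ∀ b : ℂ, (N : ℂ) ^ b * ((q : ℂ) ^ a * (P b).eval ((Real.log N : ℝ) : ℂ)) =
          (q : ℂ) ^ a * ((N : ℂ) ^ b * (P b).eval ((Real.log N : ℝ) : ℂ)) := fun b => by ring
        simp only [e1, e2]
        ring
    by_contra hP
    -- A Taylor shift keeps the leading coefficient, whereas the right side multiplies it by `q^a ≠
    -- 1`.
    have h1 : Polynomial.taylor x P₀ = Polynomial.C ((q : ℂ) ^ a) * P₀ := sub_eq_zero.1 hP₀'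
    have h2 := congrArg Polynomial.leadingCoeff h1
    rw [Polynomial.leadingCoeff_taylor, Polynomial.leadingCoeff_mul, Polynomial.leadingCoeff_C] at h2
    exact hqa (mul_right_cancel₀ (Polynomial.leadingCoeff_ne_zero.2 hP) (by rw [one_mul]; exact h2.symm))

theorem HasFinitePart.add {u v : ℕ → ℂ} {c d : ℂ} (hu : HasFinitePart u c)
    (hv : HasFinitePart v d) : HasFinitePart (fun N => u N + v N) (c + d) := by
  classical
  obtain ⟨S, b, hS, h⟩ := hu
  obtain ⟨S', b', hS', h'⟩ := hv
  refine ⟨S ∪ S', fun p => (if p ∈ S then b p else 0) + (if p ∈ S' then b' p else 0), by simp [*], ?_⟩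
  have := h.add h'
  rw [add_zero] at this
  refine this.congr fun N => ?_
  simp only [add_mul, Finset.sum_add_distrib, ite_mul, zero_mul, Finset.sum_ite_mem,
    Finset.union_inter_cancel_left, Finset.union_inter_cancel_right]
  ring

theorem HasFinitePart.const_mul {u : ℕ → ℂ} {c : ℂ} (r : ℂ) (hu : HasFinitePart u c) :
    HasFinitePart (fun N => r * u N) (r * c) := by
  obtain ⟨S, b, hS, h⟩ := hu
  refine ⟨S, fun p => r * b p, hS, ?_⟩
  have := h.const_mul r
  rw [mul_zero] at this
  refine this.congr fun N => ?_
  simp only [mul_assoc, ← Finset.mul_sum]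
  ring

theorem HasFinitePart.congr {u v : ℕ → ℂ} {c : ℂ} (hu : HasFinitePart u c)
    (huv : u =ᶠ[atTop] v) : HasFinitePart v c := by
  obtain ⟨S, b, hS, h⟩ := hu
  refine ⟨S, b, hS, h.congr' ?_⟩
  filter_upwards [huv] with N hN
  rw [hN]

theorem hasFinitePart_of_tendsto {u : ℕ → ℂ} {c : ℂ} (h : Tendsto u atTop (𝓝 c)) :
    HasFinitePart u c := by
  refine ⟨∅, 0, by simp, ?_⟩
  simpa using h.sub_const c

theorem hasFinitePart_cpow {a : ℂ} (ha : a ≠ 0) : HasFinitePart (fun N => (N : ℂ) ^ a) 0 := by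
  refine ⟨{(a, 0)}, 1, by simp [ha.symm], ?_⟩
  simp

theorem HasFinitePart.eq_zero {c : ℂ} (h : HasFinitePart 0 c) : c = 0 := by
  classical
  obtain ⟨S, b, hS, h⟩ := h
  -- Terms with the same exponent are collected into one polynomial in `log N`. As `(0, 0) ∉ S`, `P
  -- 0` has no constant term, so `c` can be read off from `C c + P 0`.
  let P : ℂ → ℂ[X] := fun a => ∑ p ∈ S with p.1 = a, Polynomial.monomial p.2 (b p)
  have key := polynomial_zero_eq_zero_of_tendsto _ ((S.image Prod.fst).erase 0)
    (fun a => (P a).natDegree + 1) P (Polynomial.C c + P 0) (Finset.notMem_erase _ _) rfl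
    (fun a _ => Polynomial.degree_le_natDegree.trans_lt (by exact_mod_cast Nat.lt_succ_self _)) (by
      have h' := h.neg
      rw [neg_zero] at h'
      refine h'.congr fun N => ?_
      have hP : ∀ a, (N : ℂ) ^ a * (P a).eval ((Real.log N : ℝ) : ℂ) =
          ∑ p ∈ S with p.1 = a, b p * ((N : ℂ) ^ p.1 * ((Real.log N : ℝ) : ℂ) ^ p.2) := by
        intro a
        simp only [P, Polynomial.eval_finsetSum, Polynomial.eval_monomial, Finset.mul_sum]
        refine Finset.sum_congr rfl fun p hp => ?_
        rw [(Finset.mem_filter.1 hp).2]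
        ring
      have h0 := hP 0
      rw [Complex.cpow_zero, one_mul] at h0
      rw [Polynomial.eval_add, h0, Polynomial.eval_C, Pi.zero_apply, zero_sub, neg_neg, add_assoc]
      congr 1
      rw [← Finset.sum_fiberwise_of_maps_to (t := insert 0 (S.image Prod.fst)) (g := Prod.fst)
        (fun p hp => Finset.mem_insert_of_mem (Finset.mem_image_of_mem _ hp)),
        ← Finset.insert_erase (Finset.mem_insert_self 0 (S.image Prod.fst)),
        Finset.sum_insert (Finset.notMem_erase _ _), Finset.erase_insert_eq_erase]
      simp only [hP])
  have h0 := congrArg (fun Q => Q.coeff 0) key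
  simp only [Polynomial.coeff_add, Polynomial.coeff_C_zero, P, Polynomial.finsetSum_coeff,
    Polynomial.coeff_zero] at h0
  rw [Finset.sum_eq_zero, add_zero] at h0
  · exact h0
  · intro p hp
    rw [Finset.mem_filter] at hp
    rw [Polynomial.coeff_monomial, if_neg]
    intro hp2
    exact hS ((Prod.ext hp.2 hp2 : p = (0, 0)) ▸ hp.1)

theorem HasFinitePart.unique {u : ℕ → ℂ} {c d : ℂ} (hc : HasFinitePart u c)
    (hd : HasFinitePart u d) : c = d := by
  have h := hc.add (hd.const_mul (-1))
  have h0 : HasFinitePart 0 (c + -1 * d) := h.congr (Eventually.of_forall fun N => by simp)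
  linear_combination h0.eq_zero

theorem HasFinitePart.finitePart_eq {u : ℕ → ℂ} {c : ℂ} (hc : HasFinitePart u c) :
    finitePart u = c := by
  have h : ∃ c, HasFinitePart u c := ⟨c, hc⟩
  rw [finitePart, dif_pos h]
  exact h.choose_spec.unique hc

/-! ### Binomial expansion with uniform remainder -/

/-- The generalised binomial coefficient `s (s - 1) ⋯ (s - l + 1) / l!`. -/
noncomputable def binomCoeff (s : ℂ) (l : ℕ) : ℂ := (∏ i ∈ Finset.range l, (s - i)) / (l.factorial : ℂ)

theorem binomCoeff_zero (s : ℂ) : binomCoeff s 0 = 1 := by simp [binomCoeff]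

theorem binomCoeff_one (s : ℂ) : binomCoeff s 1 = s := by simp [binomCoeff]

theorem succ_mul_binomCoeff (s : ℂ) (l : ℕ) :
    binomCoeff s (l + 1) * ((l + 1 : ℕ) : ℂ) = s * binomCoeff (s - 1) l := by
  have h : (l.factorial : ℂ) ≠ 0 := by exact_mod_cast l.factorial_ne_zero
  have h' : ((l : ℂ) + 1) ≠ 0 := by exact_mod_cast l.succ_ne_zero
  rw [binomCoeff, binomCoeff, Finset.prod_range_succ', Nat.factorial_succ]
  have : ∀ i : ℕ, s - ((i + 1 : ℕ) : ℂ) = s - 1 - i := fun i => by push_cast; ring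
  simp only [this]
  push_cast
  field_simp
  ring

theorem AnalyticAt.binomCoeff {f : ℂ → ℂ} {z : ℂ} (hf : AnalyticAt ℂ f z) (l : ℕ) :
    AnalyticAt ℂ (fun z => binomCoeff (f z) l) z := by
  unfold RenormZeta.binomCoeff
  refine AnalyticAt.div (Finset.analyticAt_fun_prod _ fun i _ => hf.sub analyticAt_const)
    analyticAt_const (by exact_mod_cast l.factorial_ne_zero)

/-- The remainder of the binomial series of `(1 + x)^s`. -/
noncomputable def binomRem (L : ℕ) (s : ℂ) (x : ℝ) : ℂ :=
  ((1 + x : ℝ) : ℂ) ^ s - ∑ l ∈ Finset.range L, binomCoeff s l * (x : ℂ) ^ l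

/-- By `(l + 1) (s choose l + 1) = s (s - 1 choose l)`, differentiation lowers both the exponent and
the truncation order by one; this drives the induction for the remainder bound. -/
theorem hasDerivAt_binomRem (L : ℕ) (s : ℂ) {x : ℝ} (hx : 0 ≤ x) :
    HasDerivAt (binomRem (L + 1) s) (s * binomRem L (s - 1) x) x := by
  have hslit : (1 + (x : ℂ)) ∈ Complex.slitPlane := by
    have : ((1 + x : ℝ) : ℂ) ∈ Complex.slitPlane := Complex.ofReal_mem_slitPlane.2 (by linarith)
    simpa using this
  have h2 : HasDerivAt (fun x : ℝ => ((1 + x : ℝ) : ℂ) ^ s)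
      (s * ((1 + x : ℝ) : ℂ) ^ (s - 1)) x := by
    have := (((hasDerivAt_id (x : ℂ)).const_add 1).cpow_const (c := s) hslit).comp_ofReal
    simpa using this
  have h3 : HasDerivAt (fun x : ℝ => ∑ l ∈ Finset.range (L + 1), binomCoeff s l * (x : ℂ) ^ l)
      (∑ l ∈ Finset.range (L + 1), binomCoeff s l * ((l : ℂ) * (x : ℂ) ^ (l - 1))) x := by
    refine HasDerivAt.fun_sum fun l _ => HasDerivAt.const_mul _ ?_
    exact (hasDerivAt_pow l (x : ℂ)).comp_ofReal
  refine (h2.sub h3).congr_deriv ?_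
  rw [Finset.sum_range_succ', binomRem, mul_sub, Finset.mul_sum]
  simp only [Nat.cast_zero, zero_mul, mul_zero, add_zero, Nat.add_sub_cancel]
  congr 1
  refine Finset.sum_congr rfl fun l _ => ?_
  rw [← mul_assoc, succ_mul_binomCoeff, mul_assoc]

/-- Induction on `L` by the mean value inequality, the remainder vanishing at `x = 0`. The bound `B`
on `‖s‖` is quantified inside the induction because the derivative involves `s - 1`. -/
theorem norm_binomRem_le (L : ℕ) : ∀ B : ℝ, ∃ C : ℝ, 0 ≤ C ∧ ∀ s : ℂ, ‖s‖ ≤ B → ∀ x : ℝ, 0 ≤ x → x ≤ 1 →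
    ‖binomRem L s x‖ ≤ C * x ^ L := by
  induction L with
  | zero =>
    intro B
    refine ⟨2 ^ B, by positivity, fun s hs x h0 h1 => ?_⟩
    simp only [binomRem, Finset.range_zero, Finset.sum_empty, sub_zero, pow_zero, mul_one]
    rw [Complex.norm_cpow_eq_rpow_re_of_pos (by linarith)]
    calc (1 + x) ^ s.re ≤ (1 + x) ^ B :=
          Real.rpow_le_rpow_of_exponent_le (by linarith) ((Complex.re_le_norm s).trans hs)
      _ ≤ 2 ^ B := Real.rpow_le_rpow (by linarith) (by linarith) ((norm_nonneg s).trans hs)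
  | succ L ih =>
    intro B
    obtain ⟨C, hC, h⟩ := ih (B + 1)
    refine ⟨|B| * C, by positivity, fun s hs x h0 h1 => ?_⟩
    have hs1 : ‖s - 1‖ ≤ B + 1 := (norm_sub_le _ _).trans (by simpa using hs)
    have key := (convex_Icc (0 : ℝ) x).norm_image_sub_le_of_norm_hasDerivWithin_le
      (f := binomRem (L + 1) s) (f' := fun t => s * binomRem L (s - 1) t) (C := |B| * C * x ^ L)
      (fun t ht => (hasDerivAt_binomRem L s ht.1).hasDerivWithinAt)
      (fun t ht => by
        rw [norm_mul, mul_assoc]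
        refine mul_le_mul (hs.trans (le_abs_self B)) ((h _ hs1 t ht.1 (ht.2.trans h1)).trans ?_)
          (norm_nonneg _) (abs_nonneg _)
        exact mul_le_mul_of_nonneg_left (pow_le_pow_left₀ ht.1 ht.2 L) hC)
      (Set.left_mem_Icc.2 h0) (Set.right_mem_Icc.2 h0)
    have h00 : binomRem (L + 1) s 0 = 0 := by
      simp [binomRem, Finset.sum_range_succ', binomCoeff_zero]
    rw [h00, sub_zero, sub_zero, Real.norm_of_nonneg h0] at key
    rw [pow_succ, ← mul_assoc]
    exact key

theorem succ_cpow_sub_sum (L m : ℕ) (hm : 1 ≤ m) (s : ℂ) :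
    ((m + 1 : ℕ) : ℂ) ^ s - ∑ l ∈ Finset.range L, binomCoeff s l * (m : ℂ) ^ (s - l) =
      (m : ℂ) ^ s * binomRem L s (m : ℝ)⁻¹ := by
  have hm0 : (m : ℂ) ≠ 0 := by exact_mod_cast (by omega : m ≠ 0)
  have hm1 : (m : ℝ) ≠ 0 := by exact_mod_cast (by omega : m ≠ 0)
  have h1 : ((m + 1 : ℕ) : ℂ) = ((m : ℝ) : ℂ) * ((1 + (m : ℝ)⁻¹ : ℝ) : ℂ) := by
    push_cast
    field_simp
  rw [h1, Complex.mul_cpow_ofReal_nonneg (by positivity) (by positivity), binomRem, mul_sub,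
    Finset.mul_sum, Complex.ofReal_natCast]
  congr 1
  refine Finset.sum_congr rfl fun l _ => ?_
  rw [Complex.cpow_sub _ _ hm0, Complex.cpow_natCast, Complex.ofReal_inv, Complex.ofReal_natCast,
    inv_pow]
  field_simp

/-! ### Families of sequences with meromorphic power expansions -/

/-- `IsPhg E M u`: on a punctured neighbourhood of `z = 0`, the sequences `u z N` (`N ≥ 1`) are
combinations, with coefficients meromorphic at `0`, of powers `N^(a z)` with `a ∈ E` and of
families holomorphic at `0` that are `O(N^(-M))` uniformly in `z`. -/
inductive IsPhg (E : Set (ℂ → ℂ)) (M : ℝ) : (ℂ → ℕ → ℂ) → Prop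
  | rem (r : ℂ → ℕ → ℂ) (C : ℝ) (h : ∀ᶠ z in 𝓝 (0 : ℂ), ∀ N : ℕ, 1 ≤ N →
      AnalyticAt ℂ (fun z => r z N) z ∧ ‖r z N‖ ≤ C * (N : ℝ) ^ (-M)) : IsPhg E M r
  | pow (a : ℂ → ℂ) (ha : a ∈ E) : IsPhg E M fun z N => (N : ℂ) ^ a z
  | add (u v : ℂ → ℕ → ℂ) (hu : IsPhg E M u) (hv : IsPhg E M v) : IsPhg E M fun z N => u z N + v z N
  | mul_left (b : ℂ → ℂ) (u : ℂ → ℕ → ℂ) (hb : MeromorphicAt b 0) (hu : IsPhg E M u) :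
      IsPhg E M fun z N => b z * u z N
  -- Values at `z = 0` and at `N = 0` are disregarded: coefficients may have poles at `0`, and `0^a`
  -- would be a junk value.
  | congr (u v : ℂ → ℕ → ℂ) (hu : IsPhg E M u)
      (huv : ∀ᶠ z in 𝓝[≠] (0 : ℂ), ∀ N : ℕ, 1 ≤ N → u z N = v z N) : IsPhg E M v

/-- Germs of holomorphic exponents `a` with `Re a' < 0` and `Re a < K` at `0`. -/
def decExponents (K : ℝ) : Set (ℂ → ℂ) :=
  {a | AnalyticAt ℂ a 0 ∧ (deriv a 0).re < 0 ∧ (a 0).re < K}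

theorem decExponents_mono {K K' : ℝ} (h : K ≤ K') : decExponents K ⊆ decExponents K' :=
  fun _ ha => ⟨ha.1, ha.2.1, ha.2.2.trans_le h⟩

theorem IsPhg.mono {E E' : Set (ℂ → ℂ)} {M M' : ℝ} (hE : E ⊆ E') (hM : M' ≤ M) {u : ℂ → ℕ → ℂ}
    (hu : IsPhg E M u) : IsPhg E' M' u := by
  induction hu with
  | rem r C h =>
    refine .rem r C ?_
    filter_upwards [h] with z hz N hN
    have hN' : (1 : ℝ) ≤ N := by exact_mod_cast hN
    refine ⟨(hz N hN).1, (hz N hN).2.trans ?_⟩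
    have hC : 0 ≤ C := by
      have := (norm_nonneg _).trans (hz 1 le_rfl).2
      simpa using this
    gcongr
  | pow a ha => exact .pow a (hE ha)
  | add u v _ _ hu hv => exact .add u v hu hv
  | mul_left b u hb _ hu => exact .mul_left b u hb hu
  | congr u v _ huv hu => exact .congr u v hu huv

theorem IsPhg.of_eq {E : Set (ℂ → ℂ)} {M : ℝ} {u v : ℂ → ℕ → ℂ} (hu : IsPhg E M u)
    (huv : ∀ z N, 1 ≤ N → u z N = v z N) : IsPhg E M v :=
  .congr u v hu (Eventually.of_forall huv)

theorem IsPhg.zero (E : Set (ℂ → ℂ)) (M : ℝ) : IsPhg E M fun _ _ => 0 :=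
  .rem _ 0 (Eventually.of_forall fun z N _ => ⟨analyticAt_const, by simp⟩)

theorem IsPhg.sum {E : Set (ℂ → ℂ)} {M : ℝ} {ι : Type*} (s : Finset ι) {u : ι → ℂ → ℕ → ℂ}
    (hu : ∀ i ∈ s, IsPhg E M (u i)) : IsPhg E M fun z N => ∑ i ∈ s, u i z N := by
  classical
  induction s using Finset.induction_on with
  | empty => simpa using IsPhg.zero E M
  | insert i s hi ih =>
    simp only [Finset.sum_insert hi]
    exact .add _ _ (hu i (Finset.mem_insert_self i s))
      (ih fun j hj => hu j (Finset.mem_insert_of_mem hj))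

theorem IsPhg.neg {E : Set (ℂ → ℂ)} {M : ℝ} {u : ℂ → ℕ → ℂ} (hu : IsPhg E M u) :
    IsPhg E M fun z N => -u z N :=
  (IsPhg.mul_left (fun _ => -1) u (MeromorphicAt.const _ _) hu).of_eq fun z N _ => by ring

theorem IsPhg.sub {E : Set (ℂ → ℂ)} {M : ℝ} {u v : ℂ → ℕ → ℂ} (hu : IsPhg E M u)
    (hv : IsPhg E M v) : IsPhg E M fun z N => u z N - v z N :=
  (IsPhg.add _ _ hu hv.neg).of_eq fun z N _ => by ring

theorem analyticAt_natCast_cpow {N : ℕ} (hN : 1 ≤ N) {f : ℂ → ℂ} {z : ℂ} (hf : AnalyticAt ℂ f z) :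
    AnalyticAt ℂ (fun z => (N : ℂ) ^ f z) z :=
  analyticAt_const.cpow hf (Complex.natCast_mem_slitPlane.2 (by omega))

/-- Exponents whose real parts are bounded by `K` near `0`. -/
def HasRealBound (E : Set (ℂ → ℂ)) (K : ℝ) : Prop :=
  ∀ a ∈ E, AnalyticAt ℂ a 0 ∧ ∀ᶠ z in 𝓝 (0 : ℂ), (a z).re ≤ K

theorem hasRealBound_decExponents (K : ℝ) : HasRealBound (decExponents K) K := fun _ ha =>
  ⟨ha.1, ((Complex.continuous_re.continuousAt.comp ha.1.continuousAt).eventually_lt_const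
    ha.2.2).mono fun _ h => h.le⟩

theorem hasRealBound_insert_zero {K : ℝ} (hK : 0 ≤ K) :
    HasRealBound (insert 0 (decExponents K)) K := by
  rintro a (rfl | ha)
  · exact ⟨analyticAt_const, Eventually.of_forall fun _ => by simpa using hK⟩
  · exact hasRealBound_decExponents K a ha

theorem IsPhg.pow_mul_rem {E : Set (ℂ → ℂ)} {M M' K : ℝ} (hM : M ≤ M' - K) {a : ℂ → ℂ}
    (ha : AnalyticAt ℂ a 0) (hK : ∀ᶠ z in 𝓝 (0 : ℂ), (a z).re ≤ K) {r : ℂ → ℕ → ℂ} {C : ℝ}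
    (h : ∀ᶠ z in 𝓝 (0 : ℂ), ∀ N : ℕ, 1 ≤ N →
      AnalyticAt ℂ (fun z => r z N) z ∧ ‖r z N‖ ≤ C * (N : ℝ) ^ (-M')) :
    IsPhg E M fun z N => (N : ℂ) ^ a z * r z N := by
  refine .rem _ C ?_
  filter_upwards [ha.eventually_analyticAt, hK, h] with z ha hK h N hN
  have hN' : (1 : ℝ) ≤ N := by exact_mod_cast hN
  refine ⟨(analyticAt_natCast_cpow hN ha).mul (h N hN).1, ?_⟩
  have hC : 0 ≤ C := by
    have := (norm_nonneg _).trans (h 1 le_rfl).2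
    simpa using this
  rw [norm_mul, Complex.norm_natCast_cpow_of_pos hN]
  calc (N : ℝ) ^ (a z).re * ‖r z N‖ ≤ (N : ℝ) ^ K * (C * (N : ℝ) ^ (-M')) := by
        gcongr
        · exact (h N hN).2
    _ = C * (N : ℝ) ^ (K - M') := by
        rw [sub_eq_add_neg, Real.rpow_add (by linarith)]; ring
    _ ≤ C * (N : ℝ) ^ (-M) := by
        gcongr
        · linarith

/-- The three inequalities on `M''` are what the products remainder times power, power times
remainder, and remainder times remainder require. -/
theorem IsPhg.mul {E E' E'' : Set (ℂ → ℂ)} {K K' M M' M'' : ℝ} (hE : HasRealBound E K)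
    (hE' : HasRealBound E' K') (hadd : ∀ a ∈ E, ∀ a' ∈ E', a + a' ∈ E'') (h1 : M'' ≤ M - K')
    (h2 : M'' ≤ M' - K) (h3 : M'' ≤ M + M') {u v : ℂ → ℕ → ℂ} (hu : IsPhg E M u)
    (hv : IsPhg E' M' v) : IsPhg E'' M'' fun z N => u z N * v z N := by
  induction hv with
  | add v v' _ _ hv hv' => exact (IsPhg.add _ _ hv hv').of_eq fun z N _ => by ring
  | mul_left b v hb _ hv => exact (IsPhg.mul_left b _ hb hv).of_eq fun z N _ => by ring
  | congr v v' _ hvv hv =>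
    refine .congr _ _ hv ?_
    filter_upwards [hvv] with z hz N hN
    rw [hz N hN]
  | rem r' C' h' =>
    induction hu with
    | add u u' _ _ hu hu' => exact (IsPhg.add _ _ hu hu').of_eq fun z N _ => by ring
    | mul_left b u hb _ hu => exact (IsPhg.mul_left b _ hb hu).of_eq fun z N _ => by ring
    | congr u u' _ huu hu =>
      refine .congr _ _ hu ?_
      filter_upwards [huu] with z hz N hN
      rw [hz N hN]
    | pow a ha => exact .pow_mul_rem h2 (hE a ha).1 (hE a ha).2 h'
    | rem r C h =>
      refine .rem _ (C * C') ?_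
      filter_upwards [h, h'] with z h h' N hN
      have hN' : (1 : ℝ) ≤ N := by exact_mod_cast hN
      refine ⟨(h N hN).1.mul (h' N hN).1, ?_⟩
      have hC : 0 ≤ C := by simpa using (norm_nonneg _).trans (h 1 le_rfl).2
      have hC' : 0 ≤ C' := by simpa using (norm_nonneg _).trans (h' 1 le_rfl).2
      calc ‖r z N * r' z N‖ ≤ (C * (N : ℝ) ^ (-M)) * (C' * (N : ℝ) ^ (-M')) := by
            rw [norm_mul]
            exact mul_le_mul (h N hN).2 (h' N hN).2 (norm_nonneg _) (by positivity)
        _ = C * C' * (N : ℝ) ^ (-M + -M') := by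
            rw [Real.rpow_add (by linarith)]; ring
        _ ≤ C * C' * (N : ℝ) ^ (-M'') := by
            gcongr
            · linarith
  | pow a' ha' =>
    induction hu with
    | add u u' _ _ hu hu' => exact (IsPhg.add _ _ hu hu').of_eq fun z N _ => by ring
    | mul_left b u hb _ hu => exact (IsPhg.mul_left b _ hb hu).of_eq fun z N _ => by ring
    | congr u u' _ huu hu =>
      refine .congr _ _ hu ?_
      filter_upwards [huu] with z hz N hN
      rw [hz N hN]
    | rem r C h =>
      exact (IsPhg.pow_mul_rem h1 (hE' a' ha').1 (hE' a' ha').2 h).of_eq fun z N _ => mul_comm _ _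
    | pow a ha =>
      refine (IsPhg.pow (a + a') (hadd a ha a' ha')).of_eq fun z N hN => ?_
      rw [Pi.add_apply, Complex.cpow_add _ _ (by exact_mod_cast (by omega : N ≠ 0))]

/-- Partial sums of a holomorphic remainder: the sum of the series minus a small tail. -/
theorem IsPhg.sum_rem {E : Set (ℂ → ℂ)} {M : ℝ} (hM : 0 ≤ M) (h0 : (0 : ℂ → ℂ) ∈ E)
    {r : ℂ → ℕ → ℂ} {C : ℝ} (h : ∀ᶠ z in 𝓝 (0 : ℂ), ∀ N : ℕ, 1 ≤ N →
      AnalyticAt ℂ (fun z => r z N) z ∧ ‖r z N‖ ≤ C * (N : ℝ) ^ (-(M + 2))) :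
    IsPhg E M fun z N => ∑ m ∈ Finset.Ico 1 N, r z m := by
  obtain ⟨ε, hε, hball⟩ := Metric.eventually_nhds_iff_ball.1 h
  have hC : 0 ≤ C := by
    simpa using (norm_nonneg _).trans (hball 0 (Metric.mem_ball_self hε) 1 le_rfl).2
  have hsum2 : Summable fun i : ℕ => C * ((i : ℝ) + 1) ^ (-2 : ℝ) := by
    refine Summable.mul_left C ?_
    have := (summable_nat_add_iff 1).2 (Real.summable_nat_rpow.2 (by norm_num : (-2 : ℝ) < -1))
    simpa using this
  -- The exponent `-(M + 2)` is split: `-M` bounds the tail beyond `N = 1 + k`, and `-2` leaves a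
  -- convergent series independent of `k`.
  have hb : ∀ z ∈ Metric.ball (0 : ℂ) ε, ∀ k i : ℕ, ‖r z (1 + (i + k))‖ ≤
      (((1 + k : ℕ) : ℝ)) ^ (-M) * (C * ((i : ℝ) + 1) ^ (-2 : ℝ)) := by
    intro z hz k i
    refine (hball z hz (1 + (i + k)) (by omega)).2.trans ?_
    rw [neg_add, Real.rpow_add (by positivity)]
    have e1 : ((1 + (i + k) : ℕ) : ℝ) ^ (-M) ≤ ((1 + k : ℕ) : ℝ) ^ (-M) :=
      Real.rpow_le_rpow_of_nonpos (by positivity) (by exact_mod_cast (by omega)) (by linarith)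
    have e2 : ((1 + (i + k) : ℕ) : ℝ) ^ (-2 : ℝ) ≤ ((i : ℝ) + 1) ^ (-2 : ℝ) :=
      Real.rpow_le_rpow_of_nonpos (by positivity) (by exact_mod_cast (by omega)) (by norm_num)
    calc C * (((1 + (i + k) : ℕ) : ℝ) ^ (-M) * ((1 + (i + k) : ℕ) : ℝ) ^ (-2 : ℝ))
        ≤ C * (((1 + k : ℕ) : ℝ) ^ (-M) * ((i : ℝ) + 1) ^ (-2 : ℝ)) := by gcongr
      _ = _ := by ring
  have hb0 : ∀ z ∈ Metric.ball (0 : ℂ) ε, ∀ i : ℕ, ‖r z (1 + i)‖ ≤ C * ((i : ℝ) + 1) ^ (-2 : ℝ) := by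
    intro z hz i
    simpa using hb z hz 0 i
  have hT : DifferentiableOn ℂ (fun z => ∑' i, r z (1 + i)) (Metric.ball 0 ε) :=
    Complex.differentiableOn_tsum_of_summable_norm hsum2
      (fun i z hz => (hball z hz (1 + i) (by omega)).1.differentiableAt.differentiableWithinAt)
      Metric.isOpen_ball fun i z hz => hb0 z hz i
  have hTa : ∀ z ∈ Metric.ball (0 : ℂ) ε, AnalyticAt ℂ (fun z => ∑' i, r z (1 + i)) z :=
    fun z hz => hT.analyticAt (Metric.isOpen_ball.mem_nhds hz)
  -- The full series is holomorphic in `z` and is the coefficient of `N^0`; this is where the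
  -- exponent `0` enters.
  have hP := IsPhg.mul_left (E := E) (M := M) _ _ (hTa 0 (Metric.mem_ball_self hε)).meromorphicAt
    (IsPhg.pow (0 : ℂ → ℂ) h0)
  have hR : IsPhg E M fun z N => (∑' i, r z (1 + i)) - ∑ m ∈ Finset.Ico 1 N, r z m := by
    refine .rem _ (∑' i : ℕ, C * ((i : ℝ) + 1) ^ (-2 : ℝ)) ?_
    filter_upwards [Metric.ball_mem_nhds 0 hε] with z hz N hN
    refine ⟨(hTa z hz).sub (Finset.analyticAt_fun_sum _ fun m hm =>
      (hball z hz m (Finset.mem_Ico.1 hm).1).1), ?_⟩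
    obtain ⟨k, rfl⟩ : ∃ k, N = 1 + k := ⟨N - 1, by omega⟩
    have hs : Summable fun i => r z (1 + i) := Summable.of_norm_bounded hsum2 (hb0 z hz)
    rw [Finset.sum_Ico_eq_sum_range, Nat.add_sub_cancel_left, ← hs.sum_add_tsum_nat_add k,
      add_sub_cancel_left, mul_comm]
    exact tsum_of_norm_bounded (hsum2.hasSum.mul_left _) (hb z hz k)
  refine (hP.sub hR).of_eq fun z N _ => ?_
  simp

/-- Partial sums of powers with a nonconstant holomorphic exponent. -/
theorem IsPhg.sum_pow {K M : ℝ} (hM : 0 ≤ M) (j : ℕ) : ∀ a ∈ decExponents K,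
    (a 0).re < j - M - 2 →
    IsPhg (insert 0 (decExponents (K + 1))) M fun z N => ∑ m ∈ Finset.Ico 1 N, (m : ℂ) ^ a z := by
  induction j with
  | zero =>
    intro a ha h
    refine IsPhg.sum_rem (C := 1) hM (Set.mem_insert _ _) ?_
    have h' : (a 0).re < -(M + 2) := by
      rw [Nat.cast_zero] at h; linarith
    filter_upwards [ha.1.eventually_analyticAt, (Complex.continuous_re.continuousAt.comp
      ha.1.continuousAt).eventually_lt_const h'] with z hz hz' N hN
    refine ⟨analyticAt_natCast_cpow hN hz, ?_⟩
    rw [Complex.norm_natCast_cpow_of_pos hN, one_mul]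
    exact Real.rpow_le_rpow_of_exponent_le (by exact_mod_cast hN) hz'.le
  | succ j ih =>
    intro a ha hj
    -- Since `Re s ≤ K + 1` near `0`, a binomial remainder of order `L + 2` is then `O(m^(-(M +
    -- 2)))`, as `IsPhg.sum_rem` needs.
    obtain ⟨L, hL⟩ := exists_nat_ge (K + 1 + M)
    let s : ℂ → ℂ := fun z => a z + 1
    have hs : AnalyticAt ℂ s 0 := ha.1.add analyticAt_const
    have hds : deriv s 0 = deriv a 0 := by simp [s]
    -- With `s = a + 1`, summing `(m + 1)^s - m^s` telescopes to `N^s - 1`, while its binomial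
    -- expansion starts with `s m^a`. Solving for the sum of `m^a` leaves the terms `l ≥ 2`, of
    -- order at most `a - 1` and covered by induction, and the remainder `D`.
    let D : ℂ → ℕ → ℂ := fun z m => ((m + 1 : ℕ) : ℂ) ^ s z -
      ∑ l ∈ Finset.range (L + 2), binomCoeff (s z) l * (m : ℂ) ^ (s z - l)
    have hD : IsPhg (insert 0 (decExponents (K + 1))) M
        fun z N => ∑ m ∈ Finset.Ico 1 N, D z m := by
      obtain ⟨C, hC, hb⟩ := norm_binomRem_le (L + 2) (‖s 0‖ + 1)
      refine IsPhg.sum_rem (C := C) hM (Set.mem_insert _ _) ?_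
      filter_upwards [hs.eventually_analyticAt, hs.continuousAt.norm.eventually_lt_const
        (lt_add_one ‖s 0‖), (hasRealBound_decExponents K a ha).2] with z hz hz' hre N hN
      refine ⟨(analyticAt_natCast_cpow (by omega) hz).sub (Finset.analyticAt_fun_sum _ fun l _ =>
        (AnalyticAt.binomCoeff hz l).mul
          (analyticAt_natCast_cpow hN (hz.sub analyticAt_const))), ?_⟩
      have hN' : (1 : ℝ) ≤ N := by exact_mod_cast hN
      simp only [D]
      rw [succ_cpow_sub_sum _ _ hN, norm_mul, Complex.norm_natCast_cpow_of_pos hN]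
      calc (N : ℝ) ^ (s z).re * ‖binomRem (L + 2) (s z) (N : ℝ)⁻¹‖
          ≤ (N : ℝ) ^ (K + 1) * (C * ((N : ℝ)⁻¹) ^ (L + 2)) := by
            gcongr
            · simpa [s] using hre
            · exact hb _ hz'.le _ (by positivity) (inv_le_one_of_one_le₀ hN')
        _ = C * (N : ℝ) ^ ((K + 1) - ((L + 2 : ℕ) : ℝ)) := by
            rw [Real.rpow_sub (by linarith), Real.rpow_natCast, inv_pow]
            field_simp
        _ ≤ C * (N : ℝ) ^ (-(M + 2)) := by
            gcongr
            · push_cast; linarith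
    have hlow : IsPhg (insert 0 (decExponents (K + 1))) M fun z N => ∑ l ∈ Finset.range L,
        binomCoeff (s z) (l + 2) * ∑ m ∈ Finset.Ico 1 N, (m : ℂ) ^ (s z - ((l + 2 : ℕ) : ℂ)) := by
      refine IsPhg.sum _ fun l _ =>
        .mul_left _ _ (AnalyticAt.binomCoeff hs (l + 2)).meromorphicAt ?_
      have hre : (s 0 - ((l + 2 : ℕ) : ℂ)).re = (a 0).re - l - 1 := by
        simp [s]; ring
      have hl : (0 : ℝ) ≤ l := Nat.cast_nonneg l
      refine ih (fun z => s z - ((l + 2 : ℕ) : ℂ)) ⟨hs.sub analyticAt_const, ?_, ?_⟩ ?_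
      · rw [deriv_sub_const, hds]
        exact ha.2.1
      · rw [hre]
        linarith [ha.2.2]
      · rw [hre]
        push_cast at hj
        linarith
    have hs_mem : s ∈ insert 0 (decExponents (K + 1)) := by
      refine Or.inr ⟨hs, by rw [hds]; exact ha.2.1, ?_⟩
      simpa [s] using ha.2.2
    have hY := (((IsPhg.pow s hs_mem).sub (.pow (M := M) 0 (Set.mem_insert _ _))).sub hlow).sub hD
    -- If `a(0) = -1`, where a logarithm would arise, `s` still has only an isolated zero at `0`,
    -- because `Re s'(0) < 0`; dividing by `s` gives a pole instead.
    have hne : ∀ᶠ z in 𝓝[≠] (0 : ℂ), s z ≠ 0 := by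
      refine hs.differentiableAt.hasDerivAt.eventually_ne (c := 0) fun h => ?_
      rw [hds] at h
      have := ha.2.1
      rw [h] at this
      simp at this
    refine .congr _ _ (.mul_left _ _ hs.meromorphicAt.inv hY) ?_
    filter_upwards [hne] with z hz N hN
    rw [Pi.inv_apply, inv_mul_eq_iff_eq_mul₀ hz]
    have htel : ∑ m ∈ Finset.Ico 1 N, (((m + 1 : ℕ) : ℂ) ^ s z - (m : ℂ) ^ s z) =
        (N : ℂ) ^ s z - 1 := by
      rw [Finset.sum_Ico_sub (fun m : ℕ => (m : ℂ) ^ s z) hN]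
      simp
    have hDz : ∀ m : ℕ, D z m = (((m + 1 : ℕ) : ℂ) ^ s z - (m : ℂ) ^ s z) - s z * (m : ℂ) ^ a z -
        ∑ l ∈ Finset.range L, binomCoeff (s z) (l + 2) * (m : ℂ) ^ (s z - ((l + 2 : ℕ) : ℂ)) := by
      intro m
      simp only [D]
      rw [Finset.sum_range_succ', Finset.sum_range_succ']
      simp only [Nat.cast_zero, sub_zero, binomCoeff_zero, one_mul, zero_add, binomCoeff_one,
        Nat.cast_one]
      have : s z - 1 = a z := by simp [s]
      rw [this]
      ring
    simp only [hDz, Finset.sum_sub_distrib, ← Finset.mul_sum]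
    rw [← Finset.sum_sub_distrib, htel, Finset.sum_comm]
    simp only [Finset.mul_sum, Pi.zero_apply, Complex.cpow_zero]
    ring

/-- Summation costs one in the order and two in the remainder. All exponents of the summand must be
decreasing: a constant exponent `-1` would produce a logarithm. -/
theorem IsPhg.sum_Ico {K M : ℝ} (hM : 0 ≤ M) {u : ℂ → ℕ → ℂ}
    (hu : IsPhg (decExponents K) (M + 2) u) :
    IsPhg (insert 0 (decExponents (K + 1))) M fun z N => ∑ m ∈ Finset.Ico 1 N, u z m := by
  induction hu with
  | rem r C h => exact .sum_rem hM (Set.mem_insert _ _) h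
  | pow a ha =>
    obtain ⟨j, hj⟩ := exists_nat_gt ((a 0).re + M + 2)
    exact .sum_pow hM j a ha (by linarith)
  | add u v _ _ hu hv =>
    exact (IsPhg.add _ _ hu hv).of_eq fun z N _ => by rw [Finset.sum_add_distrib]
  | mul_left b u hb _ hu =>
    exact (IsPhg.mul_left b _ hb hu).of_eq fun z N _ => by rw [Finset.mul_sum]
  | congr u v _ huv hu =>
    refine .congr _ _ hu ?_
    filter_upwards [huv] with z hz N hN
    exact Finset.sum_congr rfl fun m hm => hz m (Finset.mem_Ico.1 hm).1

/-- The finite part of a family with a meromorphic power expansion is meromorphic. -/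
theorem IsPhg.exists_hasFinitePart {K : ℝ} {u : ℂ → ℕ → ℂ}
    (hu : IsPhg (insert 0 (decExponents K)) 1 u) :
    ∃ c : ℂ → ℂ, MeromorphicAt c 0 ∧ ∀ᶠ z in 𝓝[≠] (0 : ℂ), HasFinitePart (u z) (c z) := by
  induction hu with
  | rem r C h =>
    refine ⟨fun _ => 0, MeromorphicAt.const _ _, ?_⟩
    filter_upwards [h.filter_mono nhdsWithin_le_nhds] with z hz
    refine hasFinitePart_of_tendsto ?_
    have h1 : Tendsto (fun N : ℕ => C * (N : ℝ) ^ (-1 : ℝ)) atTop (𝓝 0) := by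
      simpa using ((tendsto_rpow_neg_atTop one_pos).comp tendsto_natCast_atTop_atTop).const_mul C
    exact squeeze_zero_norm' ((eventually_ge_atTop 1).mono fun N hN => (hz N hN).2) h1
  | pow a ha =>
    rcases ha with rfl | ha
    · refine ⟨fun _ => 1, MeromorphicAt.const _ _, Eventually.of_forall fun z => ?_⟩
      exact hasFinitePart_of_tendsto (by simp)
    -- An exponent with `Re a' < 0` is nonzero off `z = 0`, so `N^a` contributes nothing to the
    -- finite part, even when `a(0) = 0`.
    · refine ⟨fun _ => 0, MeromorphicAt.const _ _, ?_⟩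
      refine (ha.1.differentiableAt.hasDerivAt.eventually_ne (c := 0) fun h => ?_).mono
        fun z hz => hasFinitePart_cpow hz
      have := ha.2.1
      rw [h] at this
      simp at this
  | add u v _ _ hu hv =>
    obtain ⟨c, hc, h⟩ := hu
    obtain ⟨d, hd, h'⟩ := hv
    exact ⟨_, hc.add hd, by filter_upwards [h, h'] with z h h' using h.add h'⟩
  | mul_left b u hb _ hu =>
    obtain ⟨c, hc, h⟩ := hu
    exact ⟨_, hb.mul hc, by filter_upwards [h] with z h using h.const_mul _⟩
  | congr u v _ huv hu =>
    obtain ⟨c, hc, h⟩ := hu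
    refine ⟨c, hc, ?_⟩
    filter_upwards [h, huv] with z h huv
    exact h.congr ((eventually_ge_atTop 1).mono fun N hN => huv N hN)

/-! ### Families of symbols and their nested sums -/

/-- The values of a family of functions on `[1, ∞)` at the integers `N ≥ 1`. -/
def atIntegers (u : ℂ → Ray → ℂ) : ℂ → ℕ → ℂ := fun z N => u z (Ray.ofSucc (N - 1))

/-- Families which, on the integers, have expansions in powers `N^(a z)` with `Re a' < 0`. -/
def IsSymbolFamily (u : ℂ → Ray → ℂ) : Prop :=
  ∃ K : ℝ, 0 ≤ K ∧ ∀ M : ℝ, IsPhg (decExponents K) M (atIntegers u)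

theorem add_mem_decExponents {K K' : ℝ} {a a' : ℂ → ℂ} (ha : a ∈ decExponents K)
    (ha' : a' ∈ decExponents K') : a + a' ∈ decExponents (K + K') := by
  refine ⟨ha.1.add ha'.1, ?_, ?_⟩
  · rw [deriv_add ha.1.differentiableAt ha'.1.differentiableAt, Complex.add_re]
    linarith [ha.2.1, ha'.2.1]
  · rw [Pi.add_apply, Complex.add_re]
    linarith [ha.2.2, ha'.2.2]

/-- The algebra of families of symbols. -/
def symbolFamilies : NonUnitalSubalgebra ℂ (ℂ → Ray → ℂ) where
  carrier := {u | IsSymbolFamily u}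
  add_mem' := by
    rintro u v ⟨K, hK, hu⟩ ⟨K', hK', hv⟩
    exact ⟨K + K', add_nonneg hK hK', fun M => .add _ _
      ((hu M).mono (decExponents_mono (by linarith)) le_rfl)
      ((hv M).mono (decExponents_mono (by linarith)) le_rfl)⟩
  zero_mem' := ⟨0, le_rfl, fun M => .zero _ _⟩
  mul_mem' := by
    rintro u v ⟨K, hK, hu⟩ ⟨K', hK', hv⟩
    refine ⟨K + K', add_nonneg hK hK', fun M => ?_⟩
    exact IsPhg.mul (M := |M| + K') (M' := |M| + K) (hasRealBound_decExponents K)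
      (hasRealBound_decExponents K') (fun a ha a' ha' => add_mem_decExponents ha ha')
      (by linarith [le_abs_self M]) (by linarith [le_abs_self M])
      (by linarith [le_abs_self M, abs_nonneg M]) (hu _) (hv _)
  smul_mem' := by
    rintro c u ⟨K, hK, hu⟩
    exact ⟨K, hK, fun M => .mul_left (fun _ => c) _ (MeromorphicAt.const _ _) (hu M)⟩

/-- A decreasing exponent plus `0` or another decreasing exponent is decreasing, so the product of a
symbol with an inner nested sum can be summed again. -/
theorem IsSymbolFamily.mul_isPhg {u : ℂ → Ray → ℂ} (hu : IsSymbolFamily u) {K : ℝ} (hK : 0 ≤ K)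
    {v : ℂ → ℕ → ℂ} (hv : ∀ M, IsPhg (insert 0 (decExponents K)) M v) :
    ∃ K' : ℝ, 0 ≤ K' ∧ ∀ M, IsPhg (decExponents K') M fun z N => atIntegers u z N * v z N := by
  obtain ⟨K', hK', hu⟩ := hu
  refine ⟨K' + K, add_nonneg hK' hK, fun M => ?_⟩
  refine IsPhg.mul (M := |M| + K) (M' := |M| + K') (hasRealBound_decExponents K')
    (hasRealBound_insert_zero hK) ?_ (by linarith [le_abs_self M]) (by linarith [le_abs_self M])
    (by linarith [le_abs_self M, abs_nonneg M]) (hu _) (hv _)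
  rintro a ha a' (rfl | ha')
  · rw [add_zero]
    exact decExponents_mono (by linarith) ha
  · exact add_mem_decExponents ha ha'

/-- The shift by one makes the recursion close: with strict inequalities, `u(n)` is multiplied by
the inner sum up to `n - 1`, and summed over `1 ≤ n < N`. -/
theorem isPhg_nestedSum_pred (w : List (ℂ → Ray → ℂ)) (hw : ∀ u ∈ w, u ∈ symbolFamilies) :
    ∃ K : ℝ, 0 ≤ K ∧ ∀ M, IsPhg (insert 0 (decExponents K)) M
      fun z N => nestedSum (w.map fun u => u z) (N - 1) := by
  induction w with
  | nil =>
    refine ⟨0, le_rfl, fun M => (IsPhg.pow 0 (Set.mem_insert _ _)).of_eq fun z N _ => ?_⟩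
    simp [nestedSum]
  | cons u w ih =>
    obtain ⟨K, hK, h⟩ := ih fun v hv => hw v (List.mem_cons_of_mem _ hv)
    obtain ⟨K', hK', h'⟩ := IsSymbolFamily.mul_isPhg (hw u List.mem_cons_self) hK h
    refine ⟨K' + 1, by linarith, fun M => ?_⟩
    refine ((IsPhg.sum_Ico (abs_nonneg M) (h' (|M| + 2))).mono subset_rfl (le_abs_self M)).of_eq
      fun z N _ => ?_
    rw [Finset.sum_Ico_eq_sum_range]
    simp [nestedSum, atIntegers]

/-- The sum up to `N` is the sum up to `N - 1` plus the term `n_1 = N`. -/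
theorem isPhg_nestedSum (w : List (ℂ → Ray → ℂ)) (hw : ∀ u ∈ w, u ∈ symbolFamilies) :
    ∃ K : ℝ, 0 ≤ K ∧ ∀ M, IsPhg (insert 0 (decExponents K)) M
      fun z N => nestedSum (w.map fun u => u z) N := by
  obtain ⟨K, hK, h⟩ := isPhg_nestedSum_pred w hw
  cases w with
  | nil => exact ⟨K, hK, fun M => (h M).of_eq fun z N _ => by simp [nestedSum]⟩
  | cons u w =>
    obtain ⟨K', hK', h'⟩ := isPhg_nestedSum_pred w fun v hv => hw v (List.mem_cons_of_mem _ hv)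
    obtain ⟨K'', hK'', h''⟩ := IsSymbolFamily.mul_isPhg (hw u List.mem_cons_self) hK' h'
    refine ⟨K + K'', by linarith, fun M => ?_⟩
    refine (IsPhg.add _ _ ((h M).mono (Set.insert_subset_insert (decExponents_mono (by linarith)))
      le_rfl) ((h'' M).mono ((decExponents_mono (by linarith)).trans (Set.subset_insert _ _))
      le_rfl)).of_eq fun z N hN => ?_
    obtain ⟨n, rfl⟩ : ∃ n, N = n + 1 := ⟨N - 1, by omega⟩
    simp [nestedSum, atIntegers, Finset.sum_range_succ]

theorem exists_hasFinitePart_nestedSum (w : List (ℂ → Ray → ℂ))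
    (hw : ∀ u ∈ w, u ∈ symbolFamilies) : ∃ c : ℂ → ℂ, MeromorphicAt c 0 ∧
      ∀ᶠ z in 𝓝[≠] (0 : ℂ), HasFinitePart (nestedSum (w.map fun u => u z)) (c z) := by
  obtain ⟨K, -, h⟩ := isPhg_nestedSum w hw
  exact (h 1).exists_hasFinitePart

/-- Only the undifferentiated remainder estimate on a closed disc about `0` is needed: with `J ≥ K +
M` and `Re α ≤ K` near `0`, it gives `O(N^(-M))`. -/
theorem IsSimpleHolFamily.isPhg {W : Set ℂ} (hW : W ∈ 𝓝 (0 : ℂ)) {α : ℂ → ℂ} {F : ℂ → ℝ → ℂ}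
    (hF : IsSimpleHolFamily W α F) (hα : (deriv α 0).re < 0) :
    ∃ K : ℝ, 0 ≤ K ∧ ∀ M : ℝ, IsPhg (decExponents K) M fun z N => F z N := by
  have hα0 : AnalyticAt ℂ α 0 := hF.order_holo.analyticAt hW
  set K : ℝ := |(α 0).re| + 1 with hKdef
  refine ⟨K, by positivity, fun M => ?_⟩
  obtain ⟨a, ha, hexp⟩ := hF.expansion
  obtain ⟨J, hJ⟩ := exists_nat_ge (K + M)
  obtain ⟨ε, hε, hball⟩ := Metric.nhds_basis_closedBall.mem_iff.1 hW
  obtain ⟨C, hC⟩ := hexp J 0 (Metric.closedBall 0 ε) hball (isCompact_closedBall _ _)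
  have hαK : ∀ j : ℕ, (fun z => α z - j) ∈ decExponents K := by
    intro j
    refine ⟨hα0.sub analyticAt_const, ?_, ?_⟩
    · rw [deriv_sub_const]
      exact hα
    · have : (0 : ℝ) ≤ j := Nat.cast_nonneg j
      simp only [Complex.sub_re, Complex.natCast_re]
      linarith [le_abs_self (α 0).re]
  have hmain : IsPhg (decExponents K) M
      fun z N => ∑ j ∈ Finset.range J, a j z * (N : ℂ) ^ (α z - (j : ℂ)) :=
    IsPhg.sum _ fun j _ => .mul_left _ _ ((ha j).analyticAt hW).meromorphicAt (.pow _ (hαK j))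
  have hrem : IsPhg (decExponents K) M
      fun z N => F z N - ∑ j ∈ Finset.range J, a j z * (N : ℂ) ^ (α z - (j : ℂ)) := by
    refine .rem _ |C| ?_
    have hα' := (hasRealBound_decExponents K _ (hαK 0)).2
    filter_upwards [eventually_mem_nhds_iff.2 hW, Metric.closedBall_mem_nhds 0 hε, hα'] with
      z hz hzε hre N hN
    have hN' : (1 : ℝ) ≤ N := by exact_mod_cast hN
    refine ⟨AnalyticAt.sub ?_ (Finset.analyticAt_fun_sum _ fun j _ => ((ha j).analyticAt hz).mul
      (analyticAt_natCast_cpow hN ((hF.order_holo.analyticAt hz).sub analyticAt_const))), ?_⟩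
    · have := (hF.holo 0 N).analyticAt hz
      simpa only [iteratedDeriv_zero] using this
    · have := hC z hzε N hN'
      simp only [iteratedDeriv_zero, Complex.ofReal_natCast, Nat.cast_zero, sub_zero] at this
      simp only [Nat.cast_zero, sub_zero] at hre
      refine this.trans (mul_le_mul (le_abs_self C) ?_ (by positivity) (abs_nonneg C))
      exact Real.rpow_le_rpow_of_exponent_le hN' (by linarith)
  exact (hmain.add _ _ hrem).of_eq fun z N _ => by ring

theorem IsHolRegularisation.mem_symbolFamilies {W : Set ℂ} {R : zetaAlg →ₗ[ℂ] ℂ → Ray → ℂ}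
    (hR : IsHolRegularisation W R) (f : zetaAlg) : R f ∈ symbolFamilies := by
  have hW : W ∈ 𝓝 (0 : ℂ) := hR.isOpen.mem_nhds hR.zero_mem
  obtain ⟨m, α, F, hF, hα, h⟩ := hR.family f
  choose K hK hPhg using fun i => (hF i).isPhg hW (hα i 0 hR.zero_mem)
  refine ⟨∑ i, K i, Finset.sum_nonneg fun i _ => hK i, fun M => ?_⟩
  refine .congr _ _ (IsPhg.sum Finset.univ fun i _ => (hPhg i M).mono (decExponents_mono
    (Finset.single_le_sum (fun j _ => hK j) (Finset.mem_univ i))) le_rfl) ?_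
  filter_upwards [nhdsWithin_le_nhds hW] with z hz N hN
  have hN' : ((Ray.ofSucc (N - 1) : Ray) : ℝ) = N := by
    simp [Ray.ofSucc, Nat.cast_sub hN]
  rw [atIntegers, h z hz, hN']

/-! ### Multilinear functions of words with values in meromorphic germs -/

section GermMultilinear

variable {B : Type*} [AddCommMonoid B] [Module ℂ B]

/-- `L` is a linear map from the span `G` to meromorphic germs at `0`. -/
structure IsGermLinear (G : Set B) (L : B → ℂ → ℂ) : Prop where
  meromorphicAt : ∀ f ∈ G, MeromorphicAt (L f) 0
  map_smul_add : ∀ (c : ℂ), ∀ f ∈ G, ∀ g ∈ G,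
    L (c • f + g) =ᶠ[𝓝[≠] (0 : ℂ)] fun z => c * L f z + L g z

/-- `Φ` is multilinear in the letters of words in `G`, with values in meromorphic germs at `0`. -/
structure IsGermMultilinear (G : Set B) (Φ : List B → ℂ → ℂ) : Prop where
  meromorphicAt : ∀ w : List B, (∀ x ∈ w, x ∈ G) → MeromorphicAt (Φ w) 0
  isGermLinear : ∀ v w : List B, (∀ x ∈ v, x ∈ G) → (∀ x ∈ w, x ∈ G) →
    IsGermLinear G fun x => Φ (v ++ x :: w)

theorem IsGermMultilinear.of_eq {G : Set B} {Φ Ψ : List B → ℂ → ℂ} (h : IsGermMultilinear G Φ)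
    (e : ∀ w z, Φ w z = Ψ w z) : IsGermMultilinear G Ψ :=
  (funext₂ e : Φ = Ψ) ▸ h

theorem IsGermLinear.add {G : Set B} {L L' : B → ℂ → ℂ} (h : IsGermLinear G L)
    (h' : IsGermLinear G L') : IsGermLinear G fun x => L x + L' x where
  meromorphicAt f hf := (h.meromorphicAt f hf).add (h'.meromorphicAt f hf)
  map_smul_add c f hf g hg := by
    filter_upwards [h.map_smul_add c f hf g hg, h'.map_smul_add c f hf g hg] with z hz hz'
    simp only [Pi.add_apply, hz, hz']
    ring

theorem IsGermLinear.zero (G : Set B) : IsGermLinear G fun _ : B => (0 : ℂ → ℂ) where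
  meromorphicAt _ _ := MeromorphicAt.const 0 0
  map_smul_add _ _ _ _ _ := Eventually.of_forall fun z => by simp

theorem IsGermLinear.sum {G : Set B} {ι : Type*} (s : Finset ι) {L : ι → B → ℂ → ℂ}
    (h : ∀ i ∈ s, IsGermLinear G (L i)) : IsGermLinear G fun x => ∑ i ∈ s, L i x := by
  classical
  induction s using Finset.induction_on with
  | empty => simpa using IsGermLinear.zero G
  | insert i s hi ih =>
    simp only [Finset.sum_insert hi]
    exact (h i (Finset.mem_insert_self i s)).add
      (ih fun j hj => h j (Finset.mem_insert_of_mem hj))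

theorem IsGermLinear.mul_left {G : Set B} {L : B → ℂ → ℂ} (h : IsGermLinear G L) {b : ℂ → ℂ}
    (hb : MeromorphicAt b 0) : IsGermLinear G fun x => b * L x where
  meromorphicAt f hf := hb.mul (h.meromorphicAt f hf)
  map_smul_add c f hf g hg := by
    filter_upwards [h.map_smul_add c f hf g hg] with z hz
    simp only [Pi.mul_apply, hz]
    ring

theorem IsGermLinear.mul_right {G : Set B} {L : B → ℂ → ℂ} (h : IsGermLinear G L) {b : ℂ → ℂ}
    (hb : MeromorphicAt b 0) : IsGermLinear G fun x => L x * b := by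
  simpa only [mul_comm] using h.mul_left hb

theorem IsGermMultilinear.comp {B' : Type*} [AddCommMonoid B'] [Module ℂ B'] {G : Set B}
    {Φ : List B → ℂ → ℂ} (h : IsGermMultilinear G Φ) {G' : Set B'} (T : B' →ₗ[ℂ] B)
    (hT : ∀ x ∈ G', T x ∈ G) : IsGermMultilinear G' fun w => Φ (w.map T) := by
  have hmem : ∀ w : List B', (∀ x ∈ w, x ∈ G') → ∀ y ∈ w.map T, y ∈ G := by
    intro w hw y hy
    obtain ⟨x, hx, rfl⟩ := List.mem_map.1 hy
    exact hT x (hw x hx)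
  refine ⟨fun w hw => h.meromorphicAt _ (hmem w hw), fun v w hv hw => ?_⟩
  have hL := h.isGermLinear _ _ (hmem v hv) (hmem w hw)
  simp only [List.map_append, List.map_cons]
  refine ⟨fun f hf => hL.meromorphicAt _ (hT f hf), fun c f hf g hg => ?_⟩
  rw [map_add, map_smul]
  exact hL.map_smul_add c _ (hT f hf) _ (hT g hg)

end GermMultilinear

/-! ### Contractions of words -/

/-- Multiply together the letters of `u` in successive blocks of lengths `b`. -/
def contractBlocks {B : Type*} [Monoid B] (u : List B) (b : List ℕ) : List B :=
  (u.splitWrtCompositionAux b).map List.prod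

theorem contractBlocks_cons {B : Type*} [Monoid B] (u : List B) (i : ℕ) (b : List ℕ) :
    contractBlocks u (i :: b) = (u.take i).prod :: contractBlocks (u.drop i) b := by
  simp [contractBlocks, List.splitWrtCompositionAux_cons]

theorem contractBlocks_map {B B' : Type*} [Monoid B] [Monoid B'] (T : B →* B') (b : List ℕ) :
    ∀ u : List B, contractBlocks (u.map T) b = (contractBlocks u b).map T := by
  induction b with
  | nil => intro u; rfl
  | cons i b ih =>
    intro u
    rw [contractBlocks_cons, contractBlocks_cons, ← List.map_take, ← List.map_drop, ih,
      List.map_cons, map_list_prod]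

/-- The type `Composition u.length` depends on the word `u`; summing a function of the block list
allows words of equal length to share one index type. -/
theorem sum_composition_congr {A : Type*} [AddCommMonoid A] {m n : ℕ} (h : m = n)
    (F : List ℕ → A) : ∑ I : Composition m, F I.blocks = ∑ I : Composition n, F I.blocks := by
  subst h
  rfl

section Contract

variable {B : Type*} [CommRing B] [Algebra ℂ B] (G : NonUnitalSubalgebra ℂ B)

theorem list_prod_mem_of_ne_nil (l : List B) (hl : l ≠ []) (h : ∀ x ∈ l, x ∈ G) : l.prod ∈ G := by
  induction l with
  | nil => exact absurd rfl hl
  | cons x l ih =>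
    rw [List.prod_cons]
    rcases eq_or_ne l [] with rfl | hne
    · simpa using h x List.mem_cons_self
    · exact G.mul_mem (h x List.mem_cons_self) (ih hne fun y hy => h y (List.mem_cons_of_mem _ hy))

theorem mem_of_mem_contractBlocks (b : List ℕ) : ∀ u : List B, (∀ x ∈ u, x ∈ G) →
    (∀ i ∈ b, 0 < i) → b.sum = u.length → ∀ y ∈ contractBlocks u b, y ∈ G := by
  induction b with
  | nil =>
    intro u _ _ _ y hy
    simp [contractBlocks, List.splitWrtCompositionAux] at hy
  | cons i b ih =>
    intro u hu hb hs y hy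
    have hi := hb i List.mem_cons_self
    rw [List.sum_cons] at hs
    rw [contractBlocks_cons, List.mem_cons] at hy
    rcases hy with rfl | hy
    · refine list_prod_mem_of_ne_nil G _ ?_ fun x hx => hu x (List.mem_of_mem_take hx)
      rw [← List.length_pos_iff, List.length_take]
      omega
    · refine ih _ (fun x hx => hu x (List.mem_of_mem_drop hx))
        (fun j hj => hb j (List.mem_cons_of_mem _ hj)) ?_ y hy
      rw [List.length_drop]
      omega

/-- Exactly one block contains the marked letter. The point is that `v'`, `w'`, `l`, `l'` do not
depend on `x`. -/
theorem exists_contractBlocks_eq (b : List ℕ) : ∀ v w : List B, (∀ x ∈ v, x ∈ G) →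
    (∀ x ∈ w, x ∈ G) → (∀ i ∈ b, 0 < i) → b.sum = v.length + w.length + 1 →
    ∃ v' w' l l' : List B, (∀ x ∈ v', x ∈ G) ∧ (∀ x ∈ w', x ∈ G) ∧ (∀ x ∈ l, x ∈ G) ∧
      (∀ x ∈ l', x ∈ G) ∧
      ∀ x, contractBlocks (v ++ x :: w) b = v' ++ (l ++ x :: l').prod :: w' := by
  induction b with
  | nil =>
    intro v w _ _ _ hs
    simp at hs
  | cons i b ih =>
    intro v w hv hw hb hs
    have hi := hb i List.mem_cons_self
    have hb' := fun j hj => hb j (List.mem_cons_of_mem i hj)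
    rw [List.sum_cons] at hs
    rcases le_or_gt i v.length with hiv | hiv
    · obtain ⟨v', w', l, l', hv', hw', hl, hl', h⟩ := ih (v.drop i) w
        (fun x hx => hv x (List.mem_of_mem_drop hx)) hw hb' (by rw [List.length_drop]; omega)
      refine ⟨(v.take i).prod :: v', w', l, l', ?_, hw', hl, hl', fun x => ?_⟩
      · rw [List.forall_mem_cons]
        refine ⟨list_prod_mem_of_ne_nil G _ ?_ fun x hx => hv x (List.mem_of_mem_take hx), hv'⟩
        rw [← List.length_pos_iff, List.length_take]
        omega
      · rw [contractBlocks_cons, List.take_append_of_le_length hiv,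
          List.drop_append_of_le_length hiv, h, List.cons_append]
    · obtain ⟨k, rfl⟩ : ∃ k, i = v.length + (k + 1) := ⟨i - v.length - 1, by omega⟩
      refine ⟨[], contractBlocks (w.drop k) b, v, w.take k, by simp, ?_, hv,
        fun x hx => hw x (List.mem_of_mem_take hx), fun x => ?_⟩
      · exact mem_of_mem_contractBlocks G b _ (fun x hx => hw x (List.mem_of_mem_drop hx)) hb'
          (by rw [List.length_drop]; omega)
      · rw [contractBlocks_cons, List.take_length_add_append, List.drop_length_add_append,
          List.take_succ_cons, List.drop_succ_cons, List.nil_append]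

/-- Each contraction replaces one letter by a block product, which is linear in that letter. Blocks
are nonempty, so a non-unital algebra `G` suffices; the constant `1` does not have decreasing
exponents. -/
theorem IsGermMultilinear.sum_contract {Φ : List B → ℂ → ℂ} (hΦ : IsGermMultilinear (G : Set B) Φ)
    (κ : List ℕ → ℂ) : IsGermMultilinear (G : Set B)
      fun u z => ∑ I : Composition u.length, κ I.blocks * Φ (contract u I) z := by
  have heq : (fun (u : List B) (z : ℂ) => ∑ I : Composition u.length, κ I.blocks * Φ (contract u I) z) =
      fun u => ∑ I : Composition u.length, (fun _ : ℂ => κ I.blocks) * Φ (contractBlocks u I.blocks) := by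
    funext u z
    rw [Finset.sum_apply]
    rfl
  rw [heq]
  refine ⟨fun w hw => MeromorphicAt.sum fun I _ => (MeromorphicAt.const _ _).mul
    (hΦ.meromorphicAt _ (mem_of_mem_contractBlocks G _ w hw (fun i hi => I.blocks_pos hi)
      I.blocks_sum)), fun v w hv hw => ?_⟩
  have hlen : ∀ x : B, (v ++ x :: w).length = v.length + w.length + 1 := fun x => by
    simp; omega
  have hsum : (fun x : B => ∑ I : Composition (v ++ x :: w).length,
      (fun _ : ℂ => κ I.blocks) * Φ (contractBlocks (v ++ x :: w) I.blocks)) =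
      fun x => ∑ I : Composition (v.length + w.length + 1),
        (fun _ : ℂ => κ I.blocks) * Φ (contractBlocks (v ++ x :: w) I.blocks) := by
    funext x
    exact sum_composition_congr (hlen x)
      fun b => (fun _ : ℂ => κ b) * Φ (contractBlocks (v ++ x :: w) b)
  rw [hsum]
  refine IsGermLinear.sum _ fun I _ => IsGermLinear.mul_left ?_ (MeromorphicAt.const _ _)
  obtain ⟨v', w', l, l', hv', hw', hl, hl', h⟩ := exists_contractBlocks_eq G I.blocks v w hv hw
    (fun i hi => I.blocks_pos hi) I.blocks_sum
  simp only [h]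
  have hL := hΦ.isGermLinear v' w' hv' hw'
  have hmem : ∀ f ∈ G, (l ++ f :: l').prod ∈ G := fun f hf => by
    refine list_prod_mem_of_ne_nil G _ (by simp) fun x hx => ?_
    rw [List.mem_append, List.mem_cons] at hx
    rcases hx with hx | rfl | hx
    exacts [hl x hx, hf, hl' x hx]
  refine ⟨fun f hf => hL.meromorphicAt _ (hmem f hf), fun c f hf g hg => ?_⟩
  have : (l ++ (c • f + g) :: l').prod = c • (l ++ f :: l').prod + (l ++ g :: l').prod := by
    simp only [List.prod_append, List.prod_cons, add_mul, mul_add, smul_mul_assoc, mul_smul_comm]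
  rw [this]
  exact hL.map_smul_add c _ (hmem f hf) _ (hmem g hg)

end Contract

/-! ### Multilinearity of regularised nested sums -/

theorem nestedSum_smul_add (c : ℂ) (f g : Ray → ℂ) (w : List (Ray → ℂ)) (v : List (Ray → ℂ)) :
    ∀ N : ℕ, nestedSum (v ++ (c • f + g) :: w) N =
      c * nestedSum (v ++ f :: w) N + nestedSum (v ++ g :: w) N := by
  induction v with
  | nil =>
    intro N
    simp only [List.nil_append, nestedSum, Pi.add_apply, Pi.smul_apply, smul_eq_mul, add_mul,
      Finset.sum_add_distrib, Finset.mul_sum, mul_assoc]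
  | cons u v ih =>
    intro N
    simp only [List.cons_append, nestedSum, ih, mul_add, Finset.sum_add_distrib, Finset.mul_sum,
      mul_left_comm]

/-- Truncated sums are multilinear for each `N`. Existence of the finite parts for `z ≠ 0` near `0`,
and their uniqueness, carry this over to the chosen value `finitePart`. -/
theorem isGermMultilinear_cutoffNestedSum :
    IsGermMultilinear (symbolFamilies : Set (ℂ → Ray → ℂ))
      fun w z => cutoffNestedSum (w.map fun u => u z) := by
  have hmer : ∀ w : List (ℂ → Ray → ℂ), (∀ u ∈ w, u ∈ symbolFamilies) →
      MeromorphicAt (fun z => cutoffNestedSum (w.map fun u => u z)) 0 := by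
    intro w hw
    obtain ⟨c, hc, h⟩ := exists_hasFinitePart_nestedSum w hw
    exact hc.congr (h.mono fun z hz => hz.finitePart_eq.symm)
  refine ⟨hmer, fun v w hv hw => ?_⟩
  have hmem : ∀ f ∈ symbolFamilies, ∀ u ∈ v ++ f :: w, u ∈ symbolFamilies := by
    intro f hf u hu
    rw [List.mem_append, List.mem_cons] at hu
    rcases hu with hu | rfl | hu
    exacts [hv u hu, hf, hw u hu]
  refine ⟨fun f hf => hmer _ (hmem f hf), fun c f hf g hg => ?_⟩
  obtain ⟨a, -, ha⟩ := exists_hasFinitePart_nestedSum _ (hmem f hf)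
  obtain ⟨b, -, hb⟩ := exists_hasFinitePart_nestedSum _ (hmem g hg)
  filter_upwards [ha, hb] with z ha hb
  have h := (ha.const_mul c).add hb
  rw [cutoffNestedSum, cutoffNestedSum, cutoffNestedSum, ha.finitePart_eq, hb.finitePart_eq]
  refine (h.congr (Eventually.of_forall fun N => ?_)).finitePart_eq
  simp only [List.map_append, List.map_cons]
  exact (nestedSum_smul_add c (f z) (g z) _ _ N).symm

theorem isGermMultilinear_regSum {W : Set ℂ} {R : zetaAlg →ₗ[ℂ] ℂ → Ray → ℂ}
    (hR : IsHolRegularisation W R) :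
    IsGermMultilinear ((⊤ : NonUnitalSubalgebra ℂ zetaAlg) : Set zetaAlg) (regSum R) := by
  have h1 := isGermMultilinear_cutoffNestedSum.sum_contract symbolFamilies
    fun b => 1 / (((b.map Nat.factorial).prod : ℕ) : ℂ)
  have h2 := h1.comp (G' := ((⊤ : NonUnitalSubalgebra ℂ zetaAlg) : Set zetaAlg)) R
    fun f _ => hR.mem_symbolFamilies f
  have h3 := h2.sum_contract ⊤ fun b => (-1) ^ (b.sum - b.length) / ((b.prod : ℕ) : ℂ)
  refine h3.of_eq fun w z => ?_
  rw [regSum, compLog]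
  symm
  refine Finset.sum_congr rfl fun I _ => ?_
  have hb : (-1 : ℂ) ^ (w.length - I.length) = (-1) ^ (I.blocks.sum - I.blocks.length) := by
    rw [I.blocks_sum, Composition.length]
  rw [hb, compExp]
  congr 1
  generalize contract w I = u
  have e1 := sum_composition_congr (m := (u.map fun f => R f z).length) (n := u.length) (by simp)
    fun b => 1 / (((b.map Nat.factorial).prod : ℕ) : ℂ) *
      cutoffNestedSum (contractBlocks (u.map fun f => R f z) b)
  have e2 := sum_composition_congr (m := (u.map R).length) (n := u.length) (by simp)
    fun b => 1 / (((b.map Nat.factorial).prod : ℕ) : ℂ) *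
      cutoffNestedSum ((contractBlocks (u.map R) b).map fun h => h z)
  refine e1.trans (Eq.trans ?_ e2.symm)
  refine Finset.sum_congr rfl fun J _ => ?_
  congr 2
  -- Evaluation at `z` is multiplicative, so contracting families and then evaluating agrees with
  -- contracting the values.
  have h4 := contractBlocks_map (Pi.evalMonoidHom (fun _ : ℂ => Ray → ℂ) z) J.blocks (u.map R)
  rw [List.map_map] at h4
  exact h4

/-! ### Pole parts and Birkhoff factorisation -/

/-- Writing `g(z) = g(0) + z g₁(z)` with `g₁` analytic peels off the term `g(0) z^(-n-1)` and lowers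
the pole order. -/
theorem exists_isPolePart_of_analyticAt (n : ℕ) : ∀ g : ℂ → ℂ, AnalyticAt ℂ g 0 →
    ∃ q, IsPolePart (fun z => z⁻¹ ^ n * g z) q := by
  induction n with
  | zero =>
    intro g hg
    exact ⟨0, by simp, g, hg, Eventually.of_forall fun z => by simp⟩
  | succ n ih =>
    intro g hg
    obtain ⟨p, hp⟩ := hg
    obtain ⟨q, hq, h, hh, he⟩ := ih (dslope g 0) hp.has_fpower_series_dslope_fslope.analyticAt
    refine ⟨q + Polynomial.monomial (n + 1) (g 0), by simp [hq, Polynomial.coeff_monomial], h, hh, ?_⟩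
    filter_upwards [he, self_mem_nhdsWithin] with z hz hz0
    have hz0 : z ≠ 0 := hz0
    have e : g z = g 0 + z * dslope g 0 z := by
      have := sub_smul_dslope g 0 z
      rw [sub_zero, smul_eq_mul] at this
      rw [this]
      ring
    rw [Polynomial.eval_add, Polynomial.eval_monomial, e, mul_add, pow_succ]
    have : z⁻¹ ^ n * z⁻¹ * (z * dslope g 0 z) = z⁻¹ ^ n * dslope g 0 z := by
      field_simp
    rw [this, hz]
    ring

theorem exists_isPolePart {g : ℂ → ℂ} (hg : MeromorphicAt g 0) : ∃ q, IsPolePart g q := by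
  obtain ⟨n, hn⟩ := hg
  obtain ⟨q, hq, h, hh, he⟩ := exists_isPolePart_of_analyticAt n _ hn
  refine ⟨q, hq, h, hh, ?_⟩
  filter_upwards [he, self_mem_nhdsWithin] with z hz hz0
  have hz0 : z ≠ 0 := hz0
  rw [← hz, sub_zero, smul_eq_mul, inv_pow, inv_mul_cancel_left₀ (pow_ne_zero n hz0)]

/-- `g` has pole part `q(1/z)` and regular part `h` at `0`. -/
def HasPoleDecomposition (g : ℂ → ℂ) (q : ℂ[X]) (h : ℂ → ℂ) : Prop :=
  q.coeff 0 = 0 ∧ AnalyticAt ℂ h 0 ∧ ∀ᶠ z in 𝓝[≠] (0 : ℂ), g z = q.eval z⁻¹ + h z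

theorem exists_hasPoleDecomposition {g : ℂ → ℂ} (hg : MeromorphicAt g 0) :
    ∃ q h, HasPoleDecomposition g q h := by
  obtain ⟨q, hq, h, hh⟩ := exists_isPolePart hg
  exact ⟨q, h, hq, hh⟩

theorem HasPoleDecomposition.smul_add {g g' : ℂ → ℂ} {q q' : ℂ[X]} {h h' : ℂ → ℂ}
    (H : HasPoleDecomposition g q h) (H' : HasPoleDecomposition g' q' h') (c : ℂ) :
    HasPoleDecomposition (fun z => c * g z + g' z) (Polynomial.C c * q + q')
      (fun z => c * h z + h' z) := by
  refine ⟨by simp [H.1, H'.1], (analyticAt_const.mul H.2.1).add H'.2.1, ?_⟩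
  filter_upwards [H.2.2, H'.2.2] with z hz hz'
  rw [hz, hz', Polynomial.eval_add, Polynomial.eval_mul, Polynomial.eval_C]
  ring

theorem HasPoleDecomposition.congr {g g' : ℂ → ℂ} {q : ℂ[X]} {h : ℂ → ℂ}
    (H : HasPoleDecomposition g q h) (hg : g' =ᶠ[𝓝[≠] (0 : ℂ)] g) :
    HasPoleDecomposition g' q h :=
  ⟨H.1, H.2.1, by filter_upwards [H.2.2, hg] with z hz hz'; rw [hz', hz]⟩

/-- A nonconstant polynomial in `1/z` blows up at `0`, while `-h` stays bounded; a constant `q`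
vanishes by the normalisation `q.coeff 0 = 0`. -/
theorem HasPoleDecomposition.eq_zero {q : ℂ[X]} {h : ℂ → ℂ} (H : HasPoleDecomposition 0 q h) :
    q = 0 := by
  by_cases hd : 0 < q.degree
  · have h1 := q.tendsto_norm_atTop hd (tendsto_norm_cobounded_atTop.comp
      (tendsto_inv₀_nhdsNE_zero (α := ℂ)))
    have h2 : Tendsto (fun z => -h z) (𝓝[≠] (0 : ℂ)) (𝓝 (-h 0)) :=
      H.2.1.continuousAt.neg.tendsto.mono_left nhdsWithin_le_nhds
    have h3 : Tendsto (fun z : ℂ => q.eval z⁻¹) (𝓝[≠] (0 : ℂ)) (𝓝 (-h 0)) := by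
      refine h2.congr' ?_
      filter_upwards [H.2.2] with z hz
      rw [Pi.zero_apply] at hz
      linear_combination hz
    exact absurd h3.norm (not_tendsto_nhds_of_tendsto_atTop h1 _)
  · have h1 := Polynomial.eq_C_of_degree_le_zero (not_lt.1 hd)
    rw [h1, H.1, Polynomial.C_0]

theorem HasPoleDecomposition.unique {g : ℂ → ℂ} {q q' : ℂ[X]} {h h' : ℂ → ℂ}
    (H : HasPoleDecomposition g q h) (H' : HasPoleDecomposition g q' h') : q = q' := by
  have := ((H.smul_add H' (-1)).congr (g' := 0)
    (Eventually.of_forall fun z => by simp)).eq_zero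
  simp only [map_neg, map_one, neg_mul, one_mul] at this
  exact (neg_add_eq_zero.1 this)

theorem HasPoleDecomposition.polePart_eq {g : ℂ → ℂ} {q : ℂ[X]} {h : ℂ → ℂ}
    (H : HasPoleDecomposition g q h) : polePart g = fun z => q.eval z⁻¹ := by
  have hex : ∃ q, IsPolePart g q := ⟨q, H.1, h, H.2⟩
  rw [polePart, dif_pos hex]
  obtain ⟨hq, h', hh'⟩ := hex.choose_spec
  have : hex.choose = q := HasPoleDecomposition.unique (h := h') ⟨hq, hh'⟩ H
  rw [this]

theorem HasPoleDecomposition.limUnder_eq {g : ℂ → ℂ} {q : ℂ[X]} {h : ℂ → ℂ}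
    (H : HasPoleDecomposition g q h) : limUnder (𝓝[≠] (0 : ℂ)) (g - polePart g) = h 0 := by
  refine Tendsto.limUnder_eq ?_
  refine (H.2.1.continuousAt.tendsto.mono_left nhdsWithin_le_nhds).congr' ?_
  filter_upwards [H.2.2] with z hz
  rw [Pi.sub_apply, H.polePart_eq, hz]
  ring

theorem meromorphicAt_polePart {g : ℂ → ℂ} (hg : MeromorphicAt g 0) :
    MeromorphicAt (polePart g) 0 := by
  obtain ⟨q, h, H⟩ := exists_hasPoleDecomposition hg
  refine (hg.sub H.2.1.meromorphicAt).congr ?_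
  filter_upwards [H.2.2] with z hz
  rw [Pi.sub_apply, H.polePart_eq, hz]
  ring

/-- The regular part of `g` at `0`, evaluated at `0`. -/
noncomputable def regularValue (g : ℂ → ℂ) : ℂ := limUnder (𝓝[≠] (0 : ℂ)) (g - polePart g)

section Linear

variable {B : Type*} [AddCommMonoid B] [Module ℂ B] {G : Set B}

theorem IsGermLinear.neg_polePart {L : B → ℂ → ℂ} (hL : IsGermLinear G L) :
    IsGermLinear G fun x => -polePart (L x) := by
  refine ⟨fun f hf => (meromorphicAt_polePart (hL.meromorphicAt f hf)).neg,
    fun c f hf g hg => Eventually.of_forall fun z => ?_⟩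
  obtain ⟨q, h, H⟩ := exists_hasPoleDecomposition (hL.meromorphicAt f hf)
  obtain ⟨q', h', H'⟩ := exists_hasPoleDecomposition (hL.meromorphicAt g hg)
  simp only [Pi.neg_apply, ((H.smul_add H' c).congr (hL.map_smul_add c f hf g hg)).polePart_eq,
    H.polePart_eq, H'.polePart_eq, Polynomial.eval_add, Polynomial.eval_mul, Polynomial.eval_C]
  ring

theorem IsGermLinear.regularValue_smul_add {L : B → ℂ → ℂ} (hL : IsGermLinear G L) (c : ℂ) {f g : B}
    (hf : f ∈ G) (hg : g ∈ G) :
    regularValue (L (c • f + g)) = c * regularValue (L f) + regularValue (L g) := by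
  obtain ⟨q, h, H⟩ := exists_hasPoleDecomposition (hL.meromorphicAt f hf)
  obtain ⟨q', h', H'⟩ := exists_hasPoleDecomposition (hL.meromorphicAt g hg)
  rw [regularValue, regularValue, regularValue, H.limUnder_eq, H'.limUnder_eq,
    ((H.smul_add H' c).congr (hL.map_smul_add c f hf g hg)).limUnder_eq]

/-- `Φ(w) + ∑ Ψ(w') Φ(w'')`, over the splittings `w = w' w''` into nonempty words. -/
noncomputable def birkhoffBar {B : Type*} (Ψ Φ : List B → ℂ → ℂ) (w : List B) : ℂ → ℂ :=
  Φ w + ∑ j ∈ Finset.range (w.length - 1), Ψ (w.take (j + 1)) * Φ (w.drop (j + 1))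

theorem birkhoffMinus_eq {B : Type*} (Φ : List B → ℂ → ℂ) {w : List B} (hw : w ≠ []) :
    birkhoffMinus Φ w = -polePart (birkhoffBar (birkhoffMinus Φ) Φ w) := by
  rw [birkhoffMinus, if_neg hw, birkhoffBar, ← Fin.sum_univ_eq_sum_range
    (fun j => birkhoffMinus Φ (w.take (j + 1)) * Φ (w.drop (j + 1)))]

theorem birkhoffPlus_eq {B : Type*} (Φ : List B → ℂ → ℂ) {w : List B} (hw : w ≠ []) :
    birkhoffPlus Φ w = birkhoffBar (birkhoffMinus Φ) Φ w -
      polePart (birkhoffBar (birkhoffMinus Φ) Φ w) := by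
  rw [birkhoffPlus, if_neg hw, birkhoffBar, ← Fin.sum_univ_eq_sum_range
    (fun j => birkhoffMinus Φ (w.take (j + 1)) * Φ (w.drop (j + 1)))]

/-- In each splitting the marked letter lies in one factor only. Linearity of `Ψ` is required only
for tails shorter than `w`, so the lemma also serves inside the induction that proves linearity of
`birkhoffMinus`. -/
theorem isGermLinear_birkhoffBar {Φ Ψ : List B → ℂ → ℂ} (hΦ : IsGermMultilinear G Φ) {v w : List B}
    (hv : ∀ x ∈ v, x ∈ G) (hw : ∀ x ∈ w, x ∈ G)
    (hmer : ∀ u : List B, (∀ x ∈ u, x ∈ G) → u.length ≤ v.length + w.length → MeromorphicAt (Ψ u) 0)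
    (hlin : ∀ u : List B, (∀ x ∈ u, x ∈ G) → u.length < w.length →
      IsGermLinear G fun x => Ψ (v ++ x :: u)) :
    IsGermLinear G fun x => birkhoffBar Ψ Φ (v ++ x :: w) := by
  have hlen : ∀ x : B, (v ++ x :: w).length - 1 = v.length + w.length := fun x => by simp
  simp only [birkhoffBar, hlen]
  refine (hΦ.isGermLinear v w hv hw).add (IsGermLinear.sum _ fun j hj => ?_)
  rw [Finset.mem_range] at hj
  rcases le_or_gt (j + 1) v.length with hjv | hjv
  · simp only [List.take_append_of_le_length hjv, List.drop_append_of_le_length hjv]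
    exact (hΦ.isGermLinear _ w (fun x hx => hv x (List.mem_of_mem_drop hx)) hw).mul_left
      (hmer _ (fun x hx => hv x (List.mem_of_mem_take hx)) (by rw [List.length_take]; omega))
  · obtain ⟨k, rfl⟩ : ∃ k, j = v.length + k := ⟨j - v.length, by omega⟩
    simp only [add_assoc, List.take_length_add_append, List.drop_length_add_append,
      List.take_succ_cons, List.drop_succ_cons]
    exact (hlin _ (fun x hx => hw x (List.mem_of_mem_take hx)) (by
      rw [List.length_take]; omega)).mul_right
      (hΦ.meromorphicAt _ fun x hx => hw x (List.mem_of_mem_drop hx))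

theorem meromorphicAt_birkhoffMinus {Φ : List B → ℂ → ℂ} (hΦ : IsGermMultilinear G Φ) (n : ℕ) :
    ∀ w : List B, (∀ x ∈ w, x ∈ G) → w.length ≤ n → MeromorphicAt (birkhoffMinus Φ w) 0 := by
  induction n with
  | zero =>
    intro w _ h
    rw [List.length_eq_zero_iff.1 (Nat.le_zero.1 h), birkhoffMinus, if_pos rfl]
    exact MeromorphicAt.const 1 0
  | succ n ih =>
    intro w hw h
    rcases eq_or_ne w [] with rfl | hne
    · exact ih [] (by simp) (by simp)
    · rw [birkhoffMinus_eq Φ hne]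
      refine (meromorphicAt_polePart ((hΦ.meromorphicAt w hw).add
        (MeromorphicAt.sum fun j hj => MeromorphicAt.mul (ih _ (fun x hx =>
          hw x (List.mem_of_mem_take hx)) ?_) (hΦ.meromorphicAt _ fun x hx =>
          hw x (List.mem_of_mem_drop hx))))).neg
      rw [Finset.mem_range] at hj
      rw [List.length_take]
      omega

theorem isGermLinear_birkhoffMinus {Φ : List B → ℂ → ℂ} (hΦ : IsGermMultilinear G Φ) {v : List B}
    (hv : ∀ x ∈ v, x ∈ G) (n : ℕ) : ∀ w : List B, (∀ x ∈ w, x ∈ G) → w.length < n →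
      IsGermLinear G fun x => birkhoffMinus Φ (v ++ x :: w) := by
  induction n with
  | zero => intro w _ h; omega
  | succ n ih =>
    intro w hw h
    simp only [birkhoffMinus_eq Φ (List.append_ne_nil_of_right_ne_nil _ (List.cons_ne_nil _ _))]
    exact (isGermLinear_birkhoffBar hΦ hv hw (fun u hu _ =>
      meromorphicAt_birkhoffMinus hΦ _ u hu le_rfl) fun u hu hlt => ih u hu (by omega)).neg_polePart

theorem limUnder_birkhoffPlus_smul_add {Φ : List B → ℂ → ℂ} (hΦ : IsGermMultilinear G Φ)
    {v w : List B} (hv : ∀ x ∈ v, x ∈ G) (hw : ∀ x ∈ w, x ∈ G) (c : ℂ) {f g : B} (hf : f ∈ G)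
    (hg : g ∈ G) :
    limUnder (𝓝[≠] (0 : ℂ)) (birkhoffPlus Φ (v ++ (c • f + g) :: w)) =
      c * limUnder (𝓝[≠] (0 : ℂ)) (birkhoffPlus Φ (v ++ f :: w)) +
        limUnder (𝓝[≠] (0 : ℂ)) (birkhoffPlus Φ (v ++ g :: w)) := by
  simp only [birkhoffPlus_eq Φ (List.append_ne_nil_of_right_ne_nil _ (List.cons_ne_nil _ _))]
  exact (isGermLinear_birkhoffBar hΦ hv hw (fun u hu _ =>
    meromorphicAt_birkhoffMinus hΦ _ u hu le_rfl) fun u hu _ =>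
      isGermLinear_birkhoffMinus hΦ hv _ u hu (Nat.lt_succ_self _)).regularValue_smul_add c hf hg

end Linear

/-! ### Renormalised nested sums as multilinear maps -/

theorem renormSum_smul_add {W : Set ℂ} {R : zetaAlg →ₗ[ℂ] ℂ → Ray → ℂ}
    (hR : IsHolRegularisation W R) (v w : List zetaAlg) (c : ℂ) (f g : zetaAlg) :
    renormSum R (v ++ (c • f + g) :: w) =
      c * renormSum R (v ++ f :: w) + renormSum R (v ++ g :: w) :=
  limUnder_birkhoffPlus_smul_add (isGermMultilinear_regSum hR) (fun _ _ => trivial)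
    (fun _ _ => trivial) c trivial trivial

theorem ofFn_update {α : Type*} {k : ℕ} (u : Fin k → α) (i : Fin k) (x : α) :
    List.ofFn (Function.update u i x) =
      (List.ofFn u).take i ++ x :: (List.ofFn u).drop (i + 1) := by
  have h : List.ofFn (Function.update u i x) = (List.ofFn u).set i x := by
    refine List.ext_getElem (by simp) fun j h1 h2 => ?_
    rw [List.getElem_set, List.getElem_ofFn, List.getElem_ofFn, Function.update_apply]
    simp only [Fin.ext_iff, eq_comm]
  rw [h, List.set_eq_take_append_cons_drop, if_pos (by simp)]

/-- The renormalised nested sum, as a multilinear function of the letters. -/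
noncomputable def renormSumMultilinear {W : Set ℂ} {R : zetaAlg →ₗ[ℂ] ℂ → Ray → ℂ}
    (hR : IsHolRegularisation W R) (k : ℕ) : MultilinearMap ℂ (fun _ : Fin k => zetaAlg) ℂ where
  toFun u := renormSum R (List.ofFn u)
  map_update_add' := by
    intro inst u i x y
    have := renormSum_smul_add hR ((List.ofFn u).take i) ((List.ofFn u).drop (i + 1)) 1 x y
    rw [one_smul, one_mul, ← ofFn_update, ← ofFn_update, ← ofFn_update] at this
    convert this
  map_update_smul' := by
    intro inst u i c x
    -- With both letters zero, the value at a zero letter equals twice itself, hence is `0`;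
    -- homogeneity is then the case of a zero second letter.
    have h0 := renormSum_smul_add hR ((List.ofFn u).take i) ((List.ofFn u).drop (i + 1)) 1 0 0
    rw [one_smul, one_mul, add_zero] at h0
    have h1 := renormSum_smul_add hR ((List.ofFn u).take i) ((List.ofFn u).drop (i + 1)) c x 0
    rw [left_eq_add.1 h0, add_zero, add_zero, ← ofFn_update, ← ofFn_update] at h1
    rw [smul_eq_mul]
    convert h1

/-! ### Radial symbols -/

/-- Expansion of the number of lattice points in a shell in powers of the radius. -/
theorem shell_eq_sum (n : ℕ) (t : ℝ) : shell n t =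
    ∑ j ∈ Finset.range (n / 2 + 1), (2 ^ (n - 2 * j) * n.choose (2 * j + 1) : ℕ) *
      t ^ (n - (2 * j + 1)) := by
  have hpair : ∀ (f : ℕ → ℝ) (k : ℕ), ∑ m ∈ Finset.range (2 * k), f m =
      ∑ j ∈ Finset.range k, (f (2 * j) + f (2 * j + 1)) := by
    intro f k
    induction k with
    | zero => simp
    | succ k ih =>
      rw [mul_add, Finset.sum_range_succ _ k, ← ih]
      simp only [mul_one, Finset.sum_range_succ, add_assoc]
  -- Here `m` is the exponent of `±1` in the two binomial expansions. The factor `1 - (-1)^m` kills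
  -- even `m` and is `2` for odd `m`, turning `2^(n-2j-1)` into `2^(n-2j)`.
  let f : ℕ → ℝ := fun m => (1 - (-1) ^ m) * (2 * t) ^ (n - m) * n.choose m
  have h1 : shell n t = ∑ m ∈ Finset.range (n + 1), f m := by
    rw [shell, add_comm, sub_eq_add_neg (2 * t), add_comm (2 * t), add_pow, add_pow,
      ← Finset.sum_sub_distrib]
    refine Finset.sum_congr rfl fun m _ => ?_
    simp only [f, one_pow]
    ring
  have h2 : ∑ m ∈ Finset.range (n + 1), f m = ∑ m ∈ Finset.range (2 * (n / 2 + 1)), f m := by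
    refine Finset.sum_subset (Finset.range_subset_range.2 (by omega)) fun m _ hm => ?_
    rw [Finset.mem_range, not_lt] at hm
    simp [f, Nat.choose_eq_zero_of_lt hm]
  rw [h1, h2, hpair]
  refine Finset.sum_congr rfl fun j _ => ?_
  rcases lt_or_ge n (2 * j + 1) with hlt | hle
  · simp [f, Nat.choose_eq_zero_of_lt hlt]
  · obtain ⟨i, hi⟩ : ∃ i, n - (2 * j + 1) = i := ⟨_, rfl⟩
    have hi' : n - 2 * j = i + 1 := by omega
    have he : (-1 : ℝ) ^ (2 * j) = 1 := (even_two_mul j).neg_one_pow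
    have ho : (-1 : ℝ) ^ (2 * j + 1) = -1 := (odd_two_mul_add_one j).neg_one_pow
    simp only [f, hi, hi', he, ho]
    push_cast
    ring

theorem shell_pos {n : ℕ} (hn : 1 ≤ n) {t : ℝ} (ht : 1 ≤ t) : 0 < shell n t :=
  sub_pos.2 (pow_lt_pow_left₀ (by linarith) (by linarith) (by omega))

/-- Every radius `ξ ≥ 1` is the supremum norm of a constant vector, and `A_n(ξ) > 0`. -/
theorem radialM_injective {n : ℕ} (hn : 1 ≤ n) : Function.Injective (radialM n) := by
  intro f g h
  refine Subtype.ext (funext fun ξ => ?_)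
  have : Nonempty (Fin n) := ⟨⟨0, hn⟩⟩
  have hnorm : ‖(fun _ : Fin n => (ξ : ℝ))‖ = ξ := by
    rw [pi_norm_const, Real.norm_of_nonneg (zero_le_one.trans ξ.2)]
  have hx := congrFun h ⟨fun _ => (ξ : ℝ), by rw [hnorm]; exact ξ.2⟩
  simp only [radialM, hnorm] at hx
  exact (div_left_inj' (Complex.ofReal_ne_zero.2 (shell_pos hn ξ.2).ne')).1 hx

theorem radialM_sum_sigma {n : ℕ} (hn : 1 ≤ n) (s : ℂ) :
    radialM n (∑ j : Fin (n / 2 + 1), ((2 ^ (n - 2 * (j : ℕ)) * n.choose (2 * j + 1) : ℕ) : ℂ) •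
      sigma (s - n + 2 * ((j : ℕ) : ℂ) + 1) 0) = radial n (sigma s 0) := by
  funext x
  have hx0 : ((‖x.1‖ : ℝ) : ℂ) ≠ 0 := by
    exact_mod_cast (zero_lt_one.trans_le x.2).ne'
  rw [radialM, radial, div_eq_iff (Complex.ofReal_ne_zero.2 (shell_pos hn x.2).ne'), shell_eq_sum,
    Fin.sum_univ_eq_sum_range (fun j : ℕ => ((2 ^ (n - 2 * j) * n.choose (2 * j + 1) : ℕ) : ℂ) •
      sigma (s - n + 2 * (j : ℂ) + 1) 0)]
  rw [Complex.ofReal_sum, Finset.mul_sum, AddSubmonoidClass.coe_finsetSum, Finset.sum_apply]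
  refine Finset.sum_congr rfl fun j hj => ?_
  -- For even `n` the index `j = n / 2` gives a truncated exponent `n - (2j + 1)`, harmless because
  -- its binomial coefficient is zero.
  rcases lt_or_ge n (2 * j + 1) with hlt | hle
  · simp [Nat.choose_eq_zero_of_lt hlt]
  · have e : -(s - n + 2 * (j : ℂ) + 1) = -s + ((n - (2 * j + 1) : ℕ) : ℂ) := by
      rw [Nat.cast_sub hle]
      push_cast
      ring
    have hσ : ∀ t : ℂ, (sigma t 0 : Ray → ℂ) ⟨‖x.1‖, x.2⟩ = ((‖x.1‖ : ℝ) : ℂ) ^ (-t) := by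
      intro t
      simp [sigma, hurwitzFun]
    rw [SetLike.val_smul, Pi.smul_apply, hσ, hσ, smul_eq_mul, e, Complex.cpow_add _ _ hx0,
      Complex.cpow_natCast, Complex.ofReal_mul, Complex.ofReal_pow, Complex.ofReal_natCast]
    ring

theorem invFun_radialM_radial_sigma {n : ℕ} (hn : 1 ≤ n) (s : ℂ) :
    Function.invFun (radialM n) (radial n (sigma s 0)) =
      ∑ j : Fin (n / 2 + 1), ((2 ^ (n - 2 * (j : ℕ)) * n.choose (2 * j + 1) : ℕ) : ℂ) •
        sigma (s - n + 2 * ((j : ℕ) : ℂ) + 1) 0 := by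
  rw [← radialM_sum_sigma hn s, Function.leftInverse_invFun (radialM_injective hn)]

theorem prod_two_pow_mul_choose (n : ℕ) {k : ℕ} (J : Fin k → Fin (n / 2 + 1)) :
    ∏ r, 2 ^ (n - 2 * (J r : ℕ)) * n.choose (2 * (J r : ℕ) + 1) =
      2 ^ (n * k - 2 * ∑ r, (J r : ℕ)) * ∏ r, n.choose (2 * (J r : ℕ) + 1) := by
  rw [Finset.prod_mul_distrib, Finset.prod_pow_eq_pow_sum]
  congr 2
  have h : ∑ r, (n - 2 * (J r : ℕ)) + 2 * ∑ r, (J r : ℕ) = n * k := by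
    rw [Finset.mul_sum, ← Finset.sum_add_distrib]
    calc ∑ r, (n - 2 * (J r : ℕ) + 2 * (J r : ℕ)) = ∑ _r : Fin k, n :=
          Finset.sum_congr rfl fun r _ => by have := (J r).2; omega
      _ = n * k := by simp [mul_comm]
  omega

end RenormZeta

/-! ### Expansion of the higher-dimensional values by multilinearity -/

theorem mainTheorem9 (W : Set ℂ) (R : zetaAlg →ₗ[ℂ] ℂ → Ray → ℂ) (hR : IsHolRegularisation W R)
    (n k : ℕ) (hn : 1 ≤ n) (s : Fin k → ℂ) :
    zetaRn R n s =
      ∑ J : Fin k → Fin (n / 2 + 1),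
        ((2 ^ (n * k - 2 * ∑ r, (J r : ℕ)) * ∏ r, n.choose (2 * (J r : ℕ) + 1) : ℕ) : ℂ) *
          zetaR R (fun r => s r - (n : ℂ) + 2 * ((J r : ℕ) : ℂ) + 1) := by
  have h1 : zetaRn R n s = renormSumMultilinear hR k fun r => ∑ j : Fin (n / 2 + 1),
      ((2 ^ (n - 2 * (j : ℕ)) * n.choose (2 * j + 1) : ℕ) : ℂ) •
        sigma (s r - n + 2 * ((j : ℕ) : ℂ) + 1) 0 := by
    simp only [zetaRn, zetaHurwitzRn, renormSumRadial, List.map_ofFn]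
    change renormSum R _ = renormSum R _
    congr 2
    funext r
    exact invFun_radialM_radial_sigma hn (s r)
  rw [h1, MultilinearMap.map_sum]
  refine Finset.sum_congr rfl fun J _ => ?_
  rw [MultilinearMap.map_smul_univ, smul_eq_mul, ← prod_two_pow_mul_choose, Nat.cast_prod]
  rfl
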